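/- Let $(\Lambda,\Lambda^*,R,R^*)$ be a reduced semisimple root datum with simple roots $\alpha_1,\dots,\alpha_r$ ($r=\operatorname{rank}\Lambda$), Weyl group $W$ generated by the simple reflections $s_1,\dots,s_r$, length function $\ell$ and Bruhat order $\le$. Let $Q(\mathbb Z[\Lambda])$ be the quotient field of the group algebra of $\Lambda$ (spanned by the $e^\lambda$, $\lambda\in\Lambda$) and let $Q_{t_1,t_2}(\Lambda)=\mathbb Z[t_1,t_2]\otimes_{\mathbb Z} Q(\mathbb Z[\Lambda])$, on which $W$ acts by $w(e^\lambda)=e^{w\lambda}$, fixing $t_1,t_2$. Let $H$ be the generic Hecke algebra over $\mathbb Z[t_1,t_2]$, with generators $h_1,\dots,h_r$, relations $(h_i-t_1)(h_i-t_2)=0$ and the braid relations of $W$, and let $H^{Q}=Q_{t_1,t_2}(\Lambda)\otimes_{\mathbb Z[t_1,t_2]}H$. For $w\in W$ with reduced expression $w=s_{i_1}\cdots s_{i_k}$ put $h_w=h_{i_1}\cdots h_{i_k}$, $\beta_j=s_{i_1}\cdots s_{i_{j-1}}(\alpha_{i_j})$, $R(w)=\{\beta_1,\dots,\beta_k\}$,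 $$Y_w=\prod_{j=1}^{k}\Bigl(h_{i_j}+\frac{t_1+t_2}{e^{-\beta_j}-1}\Bigr)\quad\text{(factors in this order)},\qquad A(w)=\prod_{\beta\in R(w)}\frac{t_1+t_2e^{-\beta}}{1-e^{\beta}} .$$ (These do not depend on the reduced expression; equivalently $Y_e=1$ and $Y_{w's_i}=Y_{w'}\bigl(h_i+\tfrac{t_1+t_2}{e^{-w'\alpha_i}-1}\bigr)$ if $w's_i>w'$.) Then there are unique coefficients $\tilde p(w,v)\in Q_{t_1,t_2}(\Lambda)$, with $\tilde p(w,v)=0$ unless $w\le v$, such that $$h_v=\sum_{w\le v}\tilde p(w,v)\,Y_w\qquad(v\in W).$$ Moreover every $A(w)$ is nonzero, and for every reduced expression $v=s_{i_1}\cdots s_{i_\ell}$ and every $w\in W$, in the quotient field of $Q_{t_1,t_2}(\Lambda)$, $$\tilde p(w,v)=\frac1{A(w)}\sum_{\substack{\epsilon\in\{0,1\}^\ell\\ s_{i_1}^{\epsilon_1}\cdots s_{i_\ell}^{\epsilon_\ell}=w}}\ \prod_{j=1}^{\ell}C_j(\epsilon),$$ where $C_j(\epsilon)=s_{i_1}^{\epsilon_1}\cdots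 s_{i_{j-1}}^{\epsilon_{j-1}}(A_{i_j})$ if $\epsilon_j=1$ and $C_j(\epsilon)=s_{i_1}^{\epsilon_1}\cdots s_{i_{j-1}}^{\epsilon_{j-1}}(B_{i_j})$ if $\epsilon_j=0$, with $$A_i=\frac{t_1+t_2e^{-\alpha_i}}{1-e^{\alpha_i}},\qquad B_i=\frac{t_1+t_2}{1-e^{-\alpha_i}} .$$ -/

import Mathlib

open scoped TensorProduct

namespace YangBaxter

noncomputable section

/-! ### Coefficient rings -/

/-- `ℤ[t₁, t₂]`. -/
abbrev ParamRing : Type := MvPolynomial (Fin 2) ℤ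

/-- The group algebra `ℤ[Λ]` of a lattice is a domain. -/
instance isDomain_groupAlgebra (Λ : Type*) [AddCommGroup Λ] [Module.Free ℤ Λ] :
    IsDomain (AddMonoidAlgebra ℤ Λ) := by
  have : TwoUniqueSums Λ :=
    TwoUniqueSums.of_injective_addHom
      (Module.Free.chooseBasis ℤ Λ).repr.toAddEquiv.toAddHom
      (Module.Free.chooseBasis ℤ Λ).repr.injective inferInstance
  have : NoZeroDivisors (AddMonoidAlgebra ℤ Λ) := inferInstance
  exact NoZeroDivisors.to_isDomain _

/-- The quotient field `Q(ℤ[Λ])` of the group algebra of `Λ`. -/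
def LatticeField (Λ : Type*) [AddCommGroup Λ] [Module.Free ℤ Λ] : Type _ :=
  FractionRing (AddMonoidAlgebra ℤ Λ)

instance (Λ : Type*) [AddCommGroup Λ] [Module.Free ℤ Λ] : Field (LatticeField Λ) :=
  inferInstanceAs (Field (FractionRing (AddMonoidAlgebra ℤ Λ)))

instance (Λ : Type*) [AddCommGroup Λ] [Module.Free ℤ Λ] :
    Algebra (AddMonoidAlgebra ℤ Λ) (LatticeField Λ) :=
  inferInstanceAs (Algebra (AddMonoidAlgebra ℤ Λ) (FractionRing (AddMonoidAlgebra ℤ Λ)))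

instance (Λ : Type*) [AddCommGroup Λ] [Module.Free ℤ Λ] :
    IsFractionRing (AddMonoidAlgebra ℤ Λ) (LatticeField Λ) :=
  inferInstanceAs
    (IsFractionRing (AddMonoidAlgebra ℤ Λ) (FractionRing (AddMonoidAlgebra ℤ Λ)))

/-- `ℤ[t₁, t₂] ⊗ Q(ℤ[Λ])`, that is, the polynomial ring in `t₁, t₂` over `Q(ℤ[Λ])`. -/
def CoeffRing (Λ : Type*) [AddCommGroup Λ] [Module.Free ℤ Λ] : Type _ :=
  MvPolynomial (Fin 2) (LatticeField Λ)

instance (Λ : Type*) [AddCommGroup Λ] [Module.Free ℤ Λ] : CommRing (CoeffRing Λ) :=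
  inferInstanceAs (CommRing (MvPolynomial (Fin 2) (LatticeField Λ)))

instance (Λ : Type*) [AddCommGroup Λ] [Module.Free ℤ Λ] : IsDomain (CoeffRing Λ) :=
  inferInstanceAs (IsDomain (MvPolynomial (Fin 2) (LatticeField Λ)))

/-- The coefficient ring as an algebra over its subring `ℤ[t₁, t₂]`. -/
instance (Λ : Type*) [AddCommGroup Λ] [Module.Free ℤ Λ] : Algebra ParamRing (CoeffRing Λ) :=
  (MvPolynomial.map (algebraMap ℤ (LatticeField Λ)) :
    MvPolynomial (Fin 2) ℤ →+* MvPolynomial (Fin 2) (LatticeField Λ)).toAlgebra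

/-- The inclusion of `Q(ℤ[Λ])` into the coefficient ring. -/
def constC {Λ : Type*} [AddCommGroup Λ] [Module.Free ℤ Λ] : LatticeField Λ →+* CoeffRing Λ :=
  (MvPolynomial.C : LatticeField Λ →+* MvPolynomial (Fin 2) (LatticeField Λ))

section Coefficients

variable {Λ : Type*} [AddCommGroup Λ] [Module.Free ℤ Λ]

/-- The element `e^μ` of `Q(ℤ[Λ])`. -/
def expo (μ : Λ) : LatticeField Λ :=
  algebraMap (AddMonoidAlgebra ℤ Λ) (LatticeField Λ) (AddMonoidAlgebra.single μ 1)

/-- `E(μ) = e^{-μ} - 1`. -/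
def bigE (μ : Λ) : LatticeField Λ := expo (-μ) - 1

variable (Λ) in
/-- The parameter `t₁` in the coefficient ring. -/
def t₁ : CoeffRing Λ := algebraMap ParamRing (CoeffRing Λ) <| MvPolynomial.X 0

variable (Λ) in
/-- The parameter `t₂` in the coefficient ring. -/
def t₂ : CoeffRing Λ := algebraMap ParamRing (CoeffRing Λ) <| MvPolynomial.X 1

/-- `(t₁ + t₂) / E(μ)`, for `μ ≠ 0`. -/
def ybCoeff (μ : Λ) : CoeffRing Λ := (t₁ Λ + t₂ Λ) * constC (bigE μ)⁻¹

/-- `(t₁ + t₂ e^{-μ}) / (1 - e^{μ})`, for `μ ≠ 0`. -/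
def coeffA (μ : Λ) : CoeffRing Λ :=
  (t₁ Λ + t₂ Λ * constC (expo (-μ))) * constC (1 - expo μ)⁻¹

/-- `(t₁ + t₂) / (1 - e^{-μ})`, for `μ ≠ 0`. -/
def coeffB (μ : Λ) : CoeffRing Λ :=
  (t₁ Λ + t₂ Λ) * constC (1 - expo (-μ))⁻¹

/-- The action on `Q(ℤ[Λ])` of a group acting on `Λ`, determined by `g (e^μ) = e^{g μ}`. -/
def fieldAct {G : Type*} [Group G] [DistribMulAction G Λ] (g : G) :
    LatticeField Λ ≃+* LatticeField Λ :=
  IsFractionRing.ringEquivOfRingEquiv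
    (AddMonoidAlgebra.mapDomainRingEquiv ℤ (DistribMulAction.toAddEquiv Λ g))

/-- The action on `ℤ[t₁, t₂] ⊗ Q(ℤ[Λ])`; the parameters `t₁, t₂` are fixed. -/
def coeffAct {G : Type*} [Group G] [DistribMulAction G Λ] (g : G) :
    CoeffRing Λ →+* CoeffRing Λ :=
  (MvPolynomial.map (fieldAct g : LatticeField Λ ≃+* LatticeField Λ).toRingHom :
    MvPolynomial (Fin 2) (LatticeField Λ) →+* MvPolynomial (Fin 2) (LatticeField Λ))

end Coefficients

/-! ### The Weyl group -/

section Weyl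

variable {ι Λ Λ' : Type*} [AddCommGroup Λ] [AddCommGroup Λ'] {P : RootDatum ι Λ Λ'} (b : P.Base)

/-- The simple reflection `s_i`. -/
def simpleRefl (i : b.support) : P.weylGroup := RootPairing.weylGroup.ofIdx P i

/-- The product `s_{i_1} ⋯ s_{i_ℓ}` of a word. -/
def wordProd (u : List b.support) : P.weylGroup := (u.map (simpleRefl b)).prod

/-- The length of a Weyl group element: the least number of simple reflections in an expression. -/
def length (w : P.weylGroup) : ℕ :=
  sInf {n | ∃ u : List b.support, wordProd b u = w ∧ u.length = n}

/-- The word `u` is a reduced expression (of its product). -/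
def IsReducedWord (u : List b.support) : Prop := u.length = length b (wordProd b u)

/-- The Weyl group acts faithfully on the lattice. -/
lemma weylGroup_ext {g g' : P.weylGroup} (h : ∀ x : Λ, g • x = g' • x) : g = g' :=
  Subtype.ext (RootPairing.Equiv.weightHom_injective P (LinearEquiv.ext h))

/-- The simple reflections generate the Weyl group. -/
lemma exists_word [Finite ι] [P.IsReduced] (w : P.weylGroup) : ∃ u : List b.support, wordProd b u = w := by
  have hcl : ∀ i : ι, ∃ u : List b.support,
      wordProd b u = RootPairing.weylGroup.ofIdx P i := by
    intro i
    refine b.induction_reflect i (p := fun i => ∃ u : List b.support,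
      wordProd b u = RootPairing.weylGroup.ofIdx P i) ?_ ?_ ?_
    · rintro i ⟨u, hu⟩
      refine ⟨u, hu.trans (weylGroup_ext fun x => ?_)⟩
      simp [RootPairing.reflection_reflectionPerm]
    · intro i hi
      exact ⟨[⟨i, hi⟩], by simp [wordProd, simpleRefl]⟩
    · rintro i j ⟨u, hu⟩ hj
      refine ⟨[⟨j, hj⟩] ++ u ++ [⟨j, hj⟩], weylGroup_ext fun x => ?_⟩
      have : wordProd b ([⟨j, hj⟩] ++ u ++ [⟨j, hj⟩]) = RootPairing.weylGroup.ofIdx P j *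
          RootPairing.weylGroup.ofIdx P i * RootPairing.weylGroup.ofIdx P j := by
        rw [← hu]
        simp [wordProd, simpleRefl, mul_assoc]
      rw [this]
      simp [RootPairing.reflection_reflectionPerm, mul_smul]
  obtain ⟨g, hg⟩ := w
  induction hg using RootPairing.weylGroup.induction with
  | mem i => exact hcl i
  | one => exact ⟨[], rfl⟩
  | mul x y hx hy ihx ihy =>
    obtain ⟨u, hu⟩ := ihx
    obtain ⟨u', hu'⟩ := ihy
    refine ⟨u ++ u', ?_⟩
    have : wordProd b (u ++ u') = wordProd b u * wordProd b u' := by simp [wordProd]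
    rw [this, hu, hu']
    rfl

/-- A reduced expression of `w` exists. -/
lemma exists_reducedWord [Finite ι] [P.IsReduced] (w : P.weylGroup) :
    ∃ u : List b.support, wordProd b u = w ∧ IsReducedWord b u := by
  have hne : {n | ∃ u : List b.support, wordProd b u = w ∧ u.length = n}.Nonempty := by
    obtain ⟨u, hu⟩ := exists_word b w
    exact ⟨_, u, hu, rfl⟩
  obtain ⟨u, hu, hl⟩ := Nat.sInf_mem hne
  refine ⟨u, hu, ?_⟩
  rw [IsReducedWord, hu]
  exact hl

/-- A reduced expression of `w`. -/
def reducedWord [Finite ι] [P.IsReduced] (w : P.weylGroup) : List b.support := (exists_reducedWord b w).choose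

/-- The Bruhat order: the reflexive and transitive closure of the relation
`x → x s_β` for reflections `s_β` with `ℓ(x) < ℓ(x s_β)`. -/
def BruhatLE : P.weylGroup → P.weylGroup → Prop :=
  Relation.ReflTransGen fun x y =>
    (∃ k : ι, y = x * RootPairing.weylGroup.ofIdx P k) ∧ length b x < length b y

/-- The `j`-th root `β_j = s_{i_1} ⋯ s_{i_{j-1}} (α_{i_j})` attached to a word. -/
def wordRoot (u : List b.support) (j : Fin u.length) : Λ :=
  wordProd b (u.take j) • P.root (u.get j)

open Classical in
/-- `R(w) = {β_1, …, β_ℓ}`, the set of roots attached to a reduced expression of `w`. -/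
def inversionRoots [Finite ι] [P.IsReduced] (w : P.weylGroup) : Finset Λ :=
  Finset.univ.image (wordRoot b (reducedWord b w))

/-- `A(w)`, the product of `(t₁ + t₂ e^{-β}) / (1 - e^{β})` over `β ∈ R(w)`. -/
def bigA [Finite ι] [P.IsReduced] [Module.Free ℤ Λ] (w : P.weylGroup) : CoeffRing Λ :=
  ∏ β ∈ inversionRoots b w, coeffA β

/-- The partial product `s_{i_1}^{ε_1} ⋯ s_{i_k}^{ε_k}` (all of them for `k ≥ ℓ`). -/
def subwordProd (u : List b.support) (ε : Fin u.length → Fin 2) (k : ℕ) : P.weylGroup :=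
  ((List.ofFn fun j : Fin u.length => simpleRefl b (u.get j) ^ (ε j : ℕ)).take k).prod

/-- `C_j(ε) = s_{i_1}^{ε_1} ⋯ s_{i_{j-1}}^{ε_{j-1}} (A_{i_j} or B_{i_j})`, according to whether
`ε_j` is `1` or `0`. (The index `j` counts from `0` here.) -/
def coeffC [Module.Free ℤ Λ] (u : List b.support) (ε : Fin u.length → Fin 2)
    (j : Fin u.length) : CoeffRing Λ :=
  coeffAct (subwordProd b u ε j)
    (if ε j = 1 then coeffA (P.root (u.get j)) else coeffB (P.root (u.get j)))

/-! ### The generic Hecke algebra -/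

/-- The defining relations of the generic Hecke algebra. -/
inductive HeckeRel :
    FreeAlgebra ParamRing b.support → FreeAlgebra ParamRing b.support → Prop
  | quadratic (i : b.support) :
      HeckeRel
        ((FreeAlgebra.ι ParamRing i - algebraMap ParamRing _ (MvPolynomial.X 0)) *
          (FreeAlgebra.ι ParamRing i - algebraMap ParamRing _ (MvPolynomial.X 1))) 0
  | braid (i j : b.support) (hij : i ≠ j) :
      HeckeRel
        ((CoxeterSystem.alternatingWord i j (orderOf (simpleRefl b i * simpleRefl b j))).map
          (FreeAlgebra.ι ParamRing)).prod
        ((CoxeterSystem.alternatingWord j i (orderOf (simpleRefl b i * simpleRefl b j))).map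
          (FreeAlgebra.ι ParamRing)).prod

/-- The generic Hecke algebra over `ℤ[t₁, t₂]`. -/
def Hecke : Type _ := RingQuot (HeckeRel b)

instance : Ring (Hecke b) := inferInstanceAs (Ring (RingQuot (HeckeRel b)))

instance : Algebra ParamRing (Hecke b) :=
  inferInstanceAs (Algebra ParamRing (RingQuot (HeckeRel b)))

/-- The generator `h_i` over `ℤ[t₁, t₂]`. -/
def hgen (i : b.support) : Hecke b :=
  RingQuot.mkAlgHom ParamRing (HeckeRel b) (FreeAlgebra.ι ParamRing i)

variable [Module.Free ℤ Λ]

/-- The generic Hecke algebra with coefficients extended to `ℤ[t₁, t₂] ⊗ Q(ℤ[Λ])`. -/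
abbrev HeckeQ : Type _ := CoeffRing Λ ⊗[ParamRing] Hecke b

/-- The generator `h_i` after extension of coefficients. -/
def gen (i : b.support) : HeckeQ b :=
  1 ⊗ₜ[ParamRing] hgen b i

/-- The basis element `h_w = h_{i_1} ⋯ h_{i_ℓ}`, for a reduced expression of `w`. -/
def heckeBasis [Finite ι] [P.IsReduced] (w : P.weylGroup) : HeckeQ b :=
  ((reducedWord b w).map (gen b)).prod

/-- The product of the `h_{i_j} + (t₁ + t₂) / E(β_j)` along a word, in order. -/
def ybWord (u : List b.support) : HeckeQ b :=
  (List.ofFn fun j : Fin u.length =>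
    gen b (u.get j) + algebraMap (CoeffRing Λ) (HeckeQ b) (ybCoeff (wordRoot b u j))).prod

/-- The Yang–Baxter element `Y_w`, computed from a reduced expression of `w`; this solves
`Y_e = 1`, `Y_{w' s_i} = Y_{w'} (h_i + (t₁ + t₂) / w' E(α_i))` for `w' s_i > w'`. -/
def ybBasis [Finite ι] [P.IsReduced] (w : P.weylGroup) : HeckeQ b := ybWord b (reducedWord b w)

/-- `p` is the matrix of coefficients in `h_v = ∑_{w ≤ v} p(w, v) Y_w`, where `p v w` stands
for `p(w, v)` and `p(w, v) = 0` unless `w ≤ v`. -/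
def IsTransition [Finite ι] [P.IsReduced] (p : P.weylGroup → P.weylGroup →₀ CoeffRing Λ) : Prop :=
  (∀ v w, p v w ≠ 0 → BruhatLE b w v) ∧
    ∀ v, heckeBasis b v = (p v).sum fun w c => c • ybBasis b w

end Weyl

end

end YangBaxter

/-! The Hecke algebra acts on the free $Q_{t_1,t_2}(\Lambda)$-module with basis $W$, viewed as the
twisted group algebra: $h_i$ acts by right multiplication by $A_i s_i + B_i$, so that $w \mapsto
w(A_i)\, w s_i + w(B_i)\, w$. Since $(t_1+t_2)/(e^{-w\alpha_i}-1) = -w(B_i)$, the factor $h_i +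
(t_1+t_2)/(e^{-w\alpha_i}-1)$ loses its diagonal term at $w$ and sends $w$ to $w(A_i)\,ws_i$. Hence
$Y_w$ sends the basis vector $1$ to $A(w)\,w$ (`heckeQHom_ybWord_single`), while $h_v$ sends it to
the sum over all subwords of a reduced word (`heckeQHom_prod_gen_single`). Comparing coefficients of
$w$ in $h_v = \sum \tilde p(w,v) Y_w$ gives the formula (`IsTransition.mul_bigA`). As $A(w) \ne 0$,
it also gives uniqueness, without linear independence of the $h_w$.

Existence is unitriangularity: $Y_w$ is $h_w$ plus terms strictly below $w$, by the lifting property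
of the Bruhat order and Matsumoto's theorem.

The main work is that the operators satisfy the braid relations (`RankTwo.dlElt_braid`). By the
Yang–Baxter equation, the difference of the two sides of a braid relation is unchanged when the
factors are shifted by suitable scalars. For each $w$ the shifts can be chosen so that both products
send $w$ to the same multiple of the same basis vector. -/

namespace YangBaxter

noncomputable section

/-! ### Roots, lengths and the exchange property in the Weyl group. -/

section WeylCombinatorics

variable {ι Λ Λ' : Type*} [AddCommGroup Λ] [AddCommGroup Λ'] {P : RootDatum ι Λ Λ'} (b : P.Base)

lemma perm_eq_iff_smul_root (w : P.weylGroup) (k l : ι) :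
    P.weylGroupToPerm w k = l ↔ w • P.root k = P.root l := by
  rw [P.weylGroup_apply_root]
  exact P.root.injective.eq_iff.symm

lemma smul_smul_root (w : P.weylGroup) (k : ι) (x : Λ) :
    w • (RootPairing.weylGroup.ofIdx P k • x) =
      RootPairing.weylGroup.ofIdx P (P.weylGroupToPerm w k) • (w • x) := by
  obtain ⟨g, hg⟩ := w
  induction hg using RootPairing.weylGroup.induction generalizing x k with
  | mem i =>
    have h : P.weylGroupToPerm (⟨_, P.reflection_mem_weylGroup i⟩ : P.weylGroup) k =
        P.reflectionPerm i k := rfl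
    rw [h]
    change P.reflection i (P.reflection k x) =
      P.reflection (P.reflectionPerm i k) (P.reflection i x)
    simp [RootPairing.reflection_reflectionPerm]
  | one => simp
  | mul g₁ g₂ hg₁ hg₂ h₁ h₂ =>
    have : (⟨g₁ * g₂, mul_mem hg₁ hg₂⟩ : P.weylGroup) = ⟨g₁, hg₁⟩ * ⟨g₂, hg₂⟩ := rfl
    rw [this, mul_smul, h₂, h₁, mul_smul, map_mul]
    rfl

lemma mul_ofIdx (w : P.weylGroup) (k : ι) :
    w * RootPairing.weylGroup.ofIdx P k =
      RootPairing.weylGroup.ofIdx P (P.weylGroupToPerm w k) * w :=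
  weylGroup_ext fun x => by simpa only [mul_smul] using smul_smul_root w k x

lemma ofIdx_mul_self (k : ι) :
    RootPairing.weylGroup.ofIdx P k * RootPairing.weylGroup.ofIdx P k = 1 :=
  weylGroup_ext fun x => by simp [mul_smul]

lemma ofIdx_perm_ofIdx (k l : ι) :
    P.weylGroupToPerm (RootPairing.weylGroup.ofIdx P k) l = P.reflectionPerm k l := rfl

@[simp] lemma wordProd_nil : wordProd b [] = 1 := rfl

@[simp] lemma wordProd_cons (i : b.support) (u : List b.support) :
    wordProd b (i :: u) = simpleRefl b i * wordProd b u := by simp [wordProd]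

@[simp] lemma wordProd_append (u v : List b.support) :
    wordProd b (u ++ v) = wordProd b u * wordProd b v := by simp [wordProd]

lemma simpleRefl_mul_self (i : b.support) : simpleRefl b i * simpleRefl b i = 1 :=
  ofIdx_mul_self _

lemma simpleRefl_mul_cancel (i : b.support) (w : P.weylGroup) :
    simpleRefl b i * (simpleRefl b i * w) = w := by
  rw [← mul_assoc, simpleRefl_mul_self, one_mul]

lemma length_wordProd_le (u : List b.support) : length b (wordProd b u) ≤ u.length :=
  Nat.sInf_le ⟨u, rfl, rfl⟩

/-- A reflection negates its own root, so composing with it flips the sign of the image. -/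
lemma isPos_perm_ofIdx_self_iff (w : P.weylGroup) (k : ι) :
    b.IsPos (P.weylGroupToPerm (w * RootPairing.weylGroup.ofIdx P k) k) ↔
      ¬ b.IsPos (P.weylGroupToPerm w k) := by
  let := P.indexNeg
  rw [← RootPairing.Base.IsPos.neg_iff_not b]
  suffices h : P.weylGroupToPerm (w * RootPairing.weylGroup.ofIdx P k) k =
      -(P.weylGroupToPerm w k) by rw [h]
  rw [perm_eq_iff_smul_root, mul_smul, smul_smul_root]
  change _ = P.root (P.reflectionPerm _ _)
  rw [P.root_reflectionPerm, P.weylGroup_apply_root]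
  rfl

lemma ofIdx_neg_eq (k : ι) :
    RootPairing.weylGroup.ofIdx P (P.reflectionPerm k k) = RootPairing.weylGroup.ofIdx P k :=
  weylGroup_ext fun x => by simp [RootPairing.reflection_reflectionPerm]

lemma isPos_simple (i : b.support) : b.IsPos i := RootPairing.Base.isPos_of_mem_support i.2

lemma wordRoot_cons_zero (i : b.support) (u : List b.support) :
    wordRoot b (i :: u) ⟨0, Nat.succ_pos _⟩ = P.root i := by simp [wordRoot]

lemma wordRoot_cons_succ (i : b.support) (u : List b.support) (j : Fin u.length) :
    wordRoot b (i :: u) j.succ = simpleRefl b i • wordRoot b u j := by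
  simp [wordRoot, mul_smul]

/-- Every reflection is the reflection in a positive root. -/
lemma exists_isPos_ofIdx_eq (k : ι) :
    ∃ l, b.IsPos l ∧ RootPairing.weylGroup.ofIdx P l = RootPairing.weylGroup.ofIdx P k := by
  rcases RootPairing.Base.IsPos.or_neg b k with h | h
  · exact ⟨k, h, rfl⟩
  · exact ⟨_, h, ofIdx_neg_eq k⟩

lemma simpleRefl_mul_eq_mul_ofIdx (i : b.support) (w : P.weylGroup) :
    simpleRefl b i * w = w * RootPairing.weylGroup.ofIdx P (P.weylGroupToPerm w⁻¹ i) := by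
  rw [mul_ofIdx, ← Equiv.Perm.mul_apply, ← map_mul, mul_inv_cancel]
  simp [simpleRefl]

lemma isReducedWord_of_le {u : List b.support} (h : u.length ≤ length b (wordProd b u)) :
    IsReducedWord b u := le_antisymm h (length_wordProd_le b u)

variable [Finite ι] [P.IsReduced]

/-- A simple reflection permutes the positive roots other than its own simple root. -/
lemma eq_of_isPos_of_not_isPos_reflectionPerm {k : ι} {p : b.support} (hk : b.IsPos k)
    (h : ¬ b.IsPos (P.reflectionPerm p k)) : k = p := by
  by_contra hne
  exact h (hk.reflectionPerm p.2 hne)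

/-- The strong exchange property, in terms of roots. -/
lemma exists_suffix_perm_eq {u : List b.support} {k : ι} (hk : b.IsPos k)
    (hneg : ¬ b.IsPos (P.weylGroupToPerm (wordProd b u) k)) :
    ∃ v p s, u = v ++ p :: s ∧ P.weylGroupToPerm (wordProd b s) k = p := by
  induction u with
  | nil => exact absurd hk (by simpa using hneg)
  | cons p s ih =>
    -- The letters act on the root from the right end of the word. Either the leftmost letter makes
    -- it negative, and then the root just before is that letter's simple root, or the sign has
    -- already changed inside `s`.
    by_cases h : b.IsPos (P.weylGroupToPerm (wordProd b s) k)
    · refine ⟨[], p, s, rfl, eq_of_isPos_of_not_isPos_reflectionPerm b h ?_⟩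
      rwa [wordProd_cons, map_mul] at hneg
    · obtain ⟨v, q, t, rfl, ht⟩ := ih h
      exact ⟨p :: v, q, t, rfl, ht⟩

/-- The strong exchange property. -/
lemma exists_suffix_conj {u : List b.support} {k : ι} (hk : b.IsPos k)
    (hneg : ¬ b.IsPos (P.weylGroupToPerm (wordProd b u) k)) :
    ∃ v p s, u = v ++ p :: s ∧
      simpleRefl b p * wordProd b s = wordProd b s * RootPairing.weylGroup.ofIdx P k := by
  obtain ⟨v, p, s, rfl, hs⟩ := exists_suffix_perm_eq b hk hneg
  exact ⟨v, p, s, rfl, by rw [mul_ofIdx, hs]; rfl⟩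

/-- By strong exchange, multiplying by the reflection deletes a letter from a reduced word. -/
lemma length_mul_ofIdx_lt {w : P.weylGroup} {k : ι} (hk : b.IsPos k)
    (hneg : ¬ b.IsPos (P.weylGroupToPerm w k)) :
    length b (w * RootPairing.weylGroup.ofIdx P k) < length b w := by
  obtain ⟨u, rfl, hu⟩ := exists_reducedWord b w
  obtain ⟨v, p, s, rfl, hs⟩ := exists_suffix_conj b hk hneg
  have h : wordProd b (v ++ p :: s) * RootPairing.weylGroup.ofIdx P k = wordProd b (v ++ s) := by
    rw [wordProd_append, wordProd_cons, wordProd_append, mul_assoc, mul_assoc, ← hs,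
      simpleRefl_mul_cancel]
  rw [h, ← hu]
  refine (length_wordProd_le b _).trans_lt ?_
  simp

lemma lt_length_mul_ofIdx {w : P.weylGroup} {k : ι} (hk : b.IsPos k)
    (hpos : b.IsPos (P.weylGroupToPerm w k)) :
    length b w < length b (w * RootPairing.weylGroup.ofIdx P k) := by
  have h := length_mul_ofIdx_lt b (w := w * RootPairing.weylGroup.ofIdx P k) hk
    (by rw [isPos_perm_ofIdx_self_iff]; exact not_not.2 hpos)
  rwa [mul_assoc, ofIdx_mul_self, mul_one] at h

/-- This trades comparisons of lengths for signs of roots. -/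
lemma isPos_perm_iff_lt {w : P.weylGroup} {k : ι} (hk : b.IsPos k) :
    b.IsPos (P.weylGroupToPerm w k) ↔
      length b w < length b (w * RootPairing.weylGroup.ofIdx P k) := by
  refine ⟨lt_length_mul_ofIdx b hk, fun h => ?_⟩
  by_contra hn
  exact absurd (length_mul_ofIdx_lt b hk hn) h.asymm

/-- Left multiplication by $s_i$ is right multiplication by the reflection in $w^{-1}\alpha_i$, and
right multiplication by a reflection always changes the length. -/
lemma length_simpleRefl_mul_ne (i : b.support) (w : P.weylGroup) :
    length b (simpleRefl b i * w) ≠ length b w := by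
  obtain ⟨l, hl, hl'⟩ := exists_isPos_ofIdx_eq b (P.weylGroupToPerm w⁻¹ i)
  rw [simpleRefl_mul_eq_mul_ofIdx, ← hl']
  by_cases hp : b.IsPos (P.weylGroupToPerm w l)
  · exact (lt_length_mul_ofIdx b hl hp).ne'
  · exact (length_mul_ofIdx_lt b hl hp).ne

lemma length_simpleRefl_mul_le (i : b.support) (w : P.weylGroup) :
    length b (simpleRefl b i * w) ≤ length b w + 1 := by
  obtain ⟨u, rfl, hu⟩ := exists_reducedWord b w
  rw [← wordProd_cons, ← hu]
  exact length_wordProd_le b _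

/-! ### Reduced words -/

variable {b}

/-- A shorter expression of the prefix would shorten the whole word. -/
lemma IsReducedWord.of_append_left {u v : List b.support} (h : IsReducedWord b (u ++ v)) :
    IsReducedWord b u := by
  refine le_antisymm ?_ (length_wordProd_le b u)
  obtain ⟨x, hx, hx'⟩ := exists_reducedWord b (wordProd b u)
  have := length_wordProd_le b (x ++ v)
  rw [wordProd_append, hx, ← wordProd_append, ← h, List.length_append, List.length_append, hx',
    hx] at this
  lia

lemma IsReducedWord.of_append_right {u v : List b.support} (h : IsReducedWord b (u ++ v)) :
    IsReducedWord b v := by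
  refine le_antisymm ?_ (length_wordProd_le b v)
  obtain ⟨x, hx, hx'⟩ := exists_reducedWord b (wordProd b v)
  have := length_wordProd_le b (u ++ x)
  rw [wordProd_append, hx, ← wordProd_append, ← h, List.length_append, List.length_append, hx',
    hx] at this
  lia

lemma IsReducedWord.isPos_of_concat {u : List b.support} {i : b.support}
    (h : IsReducedWord b (u ++ [i])) : b.IsPos (P.weylGroupToPerm (wordProd b u) i) := by
  rw [isPos_perm_iff_lt b (isPos_simple b i), ← h.of_append_left]
  have := h
  rw [IsReducedWord] at this
  simp [simpleRefl] at this
  lia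

lemma isReducedWord_cons_iff {i : b.support} {u : List b.support} (hu : IsReducedWord b u) :
    IsReducedWord b (i :: u) ↔
      length b (wordProd b u) < length b (simpleRefl b i * wordProd b u) := by
  have h1 := length_simpleRefl_mul_le b i (wordProd b u)
  rw [IsReducedWord] at hu ⊢
  rw [wordProd_cons, List.length_cons, hu]
  lia

variable (b)

lemma isReducedWord_reducedWord (w : P.weylGroup) : IsReducedWord b (reducedWord b w) :=
  (exists_reducedWord b w).choose_spec.2

@[simp] lemma wordProd_reducedWord (w : P.weylGroup) : wordProd b (reducedWord b w) = w :=
  (exists_reducedWord b w).choose_spec.1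

end WeylCombinatorics

/-! ### The Bruhat order and its lifting property. -/

section Bruhat

variable {ι Λ Λ' : Type*} [AddCommGroup Λ] [AddCommGroup Λ'] {P : RootDatum ι Λ Λ'} (b : P.Base)

lemma BruhatLE.refl (w : P.weylGroup) : BruhatLE b w w := Relation.ReflTransGen.refl

variable {b}

lemma BruhatLE.trans {x y z : P.weylGroup} (h : BruhatLE b x y) (h' : BruhatLE b y z) :
    BruhatLE b x z := Relation.ReflTransGen.trans h h'

lemma BruhatLE.eq_or_length_lt {x w : P.weylGroup} (h : BruhatLE b x w) :
    x = w ∨ length b x < length b w := by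
  induction h with
  | refl => exact .inl rfl
  | tail _ hyz ih =>
    rcases ih with rfl | h
    · exact .inr hyz.2
    · exact .inr (h.trans hyz.2)

lemma BruhatLE.antisymm {x w : P.weylGroup} (h : BruhatLE b x w) (h' : BruhatLE b w x) :
    x = w := by
  rcases h.eq_or_length_lt with h | h
  · exact h
  · rcases h'.eq_or_length_lt with h' | h'
    · exact h'.symm
    · exact absurd h h'.asymm

lemma bruhatLE_simpleRefl_mul {i : b.support} {w : P.weylGroup}
    (h : length b w < length b (simpleRefl b i * w)) : BruhatLE b w (simpleRefl b i * w) :=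
  .single ⟨⟨_, simpleRefl_mul_eq_mul_ofIdx b i w⟩, h⟩

variable [Finite ι] [P.IsReduced]

/-- The lifting property of the Bruhat order. -/
lemma BruhatLE.simpleRefl_mul {x w : P.weylGroup} (h : BruhatLE b x w) (i : b.support) :
    BruhatLE b (simpleRefl b i * x) w ∨
      BruhatLE b (simpleRefl b i * x) (simpleRefl b i * w) := by
  induction h using Relation.ReflTransGen.head_induction_on with
  | refl => exact .inr (.refl b _)
  | head hxy hyw ih =>
    rename_i x y
    obtain ⟨⟨k, rfl⟩, hlt⟩ := hxy
    obtain ⟨l, hl, hlk⟩ := exists_isPos_ofIdx_eq b k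
    rw [← hlk] at hlt hyw ih
    have hpos := (isPos_perm_iff_lt b hl).2 hlt
    -- If $x$ sends the root of `l` to $\alpha_i$, then $s_i x$ is the next element of the chain,
    -- already below $w$. Otherwise $s_i$ keeps the image root positive, so the step of the chain
    -- survives multiplication by $s_i$.
    by_cases hi : P.weylGroupToPerm x l = i
    · refine .inl ?_
      rw [mul_ofIdx, hi] at hyw
      exact hyw
    · have hpos' : b.IsPos (P.weylGroupToPerm (simpleRefl b i * x) l) := by
        rw [map_mul]
        exact hpos.reflectionPerm i.2 hi
      have hstep : BruhatLE b (simpleRefl b i * x)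
          (simpleRefl b i * (x * RootPairing.weylGroup.ofIdx P l)) := by
        refine .single ⟨⟨l, (mul_assoc _ _ _).symm⟩, ?_⟩
        rw [← mul_assoc]
        exact (isPos_perm_iff_lt b hl).1 hpos'
      exact ih.imp hstep.trans hstep.trans

end Bruhat

/-! ### Matsumoto's theorem on reduced words. -/

section Matsumoto

variable {ι Λ Λ' : Type*} [AddCommGroup Λ] [AddCommGroup Λ'] {P : RootDatum ι Λ Λ'} {b : P.Base}

open CoxeterSystem (alternatingWord)

lemma pow_mul_left_of_involutive {G : Type*} [Group G] {s t : G} (hs : s * s = 1) (ht : t * t = 1)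
    (k : ℕ) : (s * t) ^ k * s * (s * t) ^ k = s := by
  induction k with
  | zero => simp
  | succ k ih =>
    calc (s * t) ^ (k + 1) * s * (s * t) ^ (k + 1)
        = (s * t) ^ k * s * (t * ((s * s) * t)) * (s * t) ^ k := by
          nth_rw 2 [pow_succ']
          rw [pow_succ]
          simp only [mul_assoc]
      _ = s := by rw [hs, one_mul, ht, mul_one, ih]

/-- The power of the rotation measures the failure of a braid relation of length `k`; it is trivial
when `k` is the order of the rotation. -/
lemma wordProd_alternatingWord_swap (i j : b.support) (k : ℕ) :
    wordProd b (alternatingWord j i k) =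
      wordProd b (alternatingWord i j k) * (simpleRefl b j * simpleRefl b i) ^ k := by
  induction k with
  | zero => simp [alternatingWord]
  | succ k ih =>
    have h := pow_mul_left_of_involutive (simpleRefl_mul_self b j) (simpleRefl_mul_self b i) k
    simp only [alternatingWord, List.concat_eq_append, wordProd_append, wordProd_cons,
      wordProd_nil, mul_one, ih]
    rw [pow_succ, mul_assoc, mul_assoc, ← mul_assoc (simpleRefl b j) (_ ^ k), ← mul_assoc (_ ^ k),
      ← mul_assoc (_ ^ k), h, simpleRefl_mul_cancel]

lemma pow_eq_one_of_wordProd_alternatingWord_eq {i j : b.support} {k : ℕ}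
    (h : wordProd b (alternatingWord j i k) = wordProd b (alternatingWord i j k)) :
    (simpleRefl b i * simpleRefl b j) ^ k = 1 := by
  rw [wordProd_alternatingWord_swap, mul_eq_left] at h
  rw [← inv_eq_one, ← inv_pow, mul_inv_rev, inv_eq_of_mul_eq_one_left (simpleRefl_mul_self b i),
    inv_eq_of_mul_eq_one_left (simpleRefl_mul_self b j), h]

lemma alternatingWord_suffix {B : Type*} {i j p : B} {v s : List B} {n : ℕ}
    (h : alternatingWord j i n = v ++ p :: s) :
    p :: s = alternatingWord j i (s.length + 1) ∧ s = alternatingWord j i s.length := by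
  induction n generalizing v with
  | zero => simp [alternatingWord] at h
  | succ n ih =>
    rw [CoxeterSystem.alternatingWord_succ'] at h
    cases v with
    | nil =>
      simp only [List.nil_append, List.cons.injEq] at h
      obtain ⟨rfl, rfl⟩ := h
      rw [CoxeterSystem.length_alternatingWord, CoxeterSystem.alternatingWord_succ']
      exact ⟨rfl, rfl⟩
    | cons x v =>
      simp only [List.cons_append, List.cons.injEq] at h
      exact ih h.2

variable [Finite ι] [P.IsReduced]

/-- `i` is a right descent of every element with a reduced expression ending in `i`. -/
lemma IsReducedWord.not_isPos_of_concat {u : List b.support} {i : b.support}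
    (h : IsReducedWord b (u ++ [i])) :
    ¬ b.IsPos (P.weylGroupToPerm (wordProd b (u ++ [i])) i) := by
  rw [wordProd_append, wordProd_cons, wordProd_nil, mul_one]
  exact (isPos_perm_ofIdx_self_iff b _ _).not.2 (not_not.2 h.isPos_of_concat)

/-- An element with right descents `i` and `j` has reduced expressions ending in long
alternating words. -/
lemma exists_reducedWord_append_alternatingWord {i j : b.support} {w : P.weylGroup}
    (hi : ¬ b.IsPos (P.weylGroupToPerm w i)) (hj : ¬ b.IsPos (P.weylGroupToPerm w j)) (n : ℕ)
    (hn : n ≤ orderOf (simpleRefl b i * simpleRefl b j)) :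
    ∃ y, (wordProd b (y ++ alternatingWord i j n) = w ∧
        IsReducedWord b (y ++ alternatingWord i j n)) ∨
      (wordProd b (y ++ alternatingWord j i n) = w ∧
        IsReducedWord b (y ++ alternatingWord j i n)) := by
  -- Exchange with the descent $s_j$ appends `j` and deletes another letter. That letter cannot lie
  -- in the alternating block: this would be a braid relation of length at most `n`, less than the
  -- order of $s_i s_j$. So the block grows by one.
  have key : ∀ (i j : b.support) (n : ℕ) (y : List b.support),
      ¬ b.IsPos (P.weylGroupToPerm w j) → n < orderOf (simpleRefl b i * simpleRefl b j) →
      wordProd b (y ++ alternatingWord j i n) = w →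
      IsReducedWord b (y ++ alternatingWord j i n) →
      ∃ y', wordProd b (y' ++ alternatingWord i j (n + 1)) = w ∧
        IsReducedWord b (y' ++ alternatingWord i j (n + 1)) := by
    intro i j n y hj hn hw hred
    rw [← hw] at hj
    obtain ⟨v, p, s, hu, hs⟩ := exists_suffix_conj b (isPos_simple b j) hj
    rcases List.append_eq_append_iff.1 hu with ⟨c, rfl, hc⟩ | ⟨c, hc, hc'⟩
    · exfalso
      obtain ⟨h1, h2⟩ := alternatingWord_suffix hc
      have hl : s.length + 1 ≤ n := by
        have := congr_arg List.length hc
        simp at this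
        lia
      rw [← wordProd_cons, h1] at hs
      nth_rw 2 [h2] at hs
      have h3 := pow_eq_one_of_wordProd_alternatingWord_eq (i := i) (j := j) (k := s.length + 1) (by
        rw [hs]
        simp [alternatingWord, simpleRefl])
      exact absurd (orderOf_le_of_pow_eq_one (by lia) h3) (by lia)
    · cases c with
      -- Boundary of the case split: the deleted letter is the first one of the alternating block.
      | nil =>
        exfalso
        simp only [List.nil_append] at hc'
        obtain ⟨h1, h2⟩ := alternatingWord_suffix (v := []) (by simpa using hc'.symm)
        have hl : s.length + 1 ≤ n := by
          have := congr_arg List.length hc'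
          simp at this
          lia
        rw [← wordProd_cons, h1] at hs
        nth_rw 2 [h2] at hs
        have h3 := pow_eq_one_of_wordProd_alternatingWord_eq (i := i) (j := j)
          (k := s.length + 1) (by
            rw [hs]
            simp [alternatingWord, simpleRefl])
        exact absurd (orderOf_le_of_pow_eq_one (by lia) h3) (by lia)
      | cons q c =>
        simp only [List.cons_append, List.cons.injEq] at hc'
        obtain ⟨rfl, rfl⟩ := hc'
        have hw' : wordProd b ((v ++ c) ++ alternatingWord i j (n + 1)) = w := by
          rw [← hw, hu]
          have hs' : wordProd b (c ++ alternatingWord j i n) * simpleRefl b j =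
              simpleRefl b p * wordProd b (c ++ alternatingWord j i n) := hs.symm
          simp only [alternatingWord, List.concat_eq_append, wordProd_append, wordProd_cons,
            wordProd_nil, mul_one, mul_assoc] at hs' ⊢
          rw [hs']
        refine ⟨v ++ c, hw', isReducedWord_of_le b ?_⟩
        rw [hw', ← hw, ← hred, hc]
        simp
        lia
  induction n with
  | zero =>
    obtain ⟨u, hu, hu'⟩ := exists_reducedWord b w
    exact ⟨u, .inl (by simpa [alternatingWord] using ⟨hu, hu'⟩)⟩
  | succ n ih =>
    obtain ⟨y, ⟨h1, h2⟩ | ⟨h1, h2⟩⟩ := ih (by lia)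
    · obtain ⟨y', hy'⟩ := key j i n y hi (by rwa [← orderOf_inv, mul_inv_rev,
        inv_eq_of_mul_eq_one_left (simpleRefl_mul_self b i),
        inv_eq_of_mul_eq_one_left (simpleRefl_mul_self b j)]) h1 h2
      exact ⟨y', .inr hy'⟩
    · obtain ⟨y', hy'⟩ := key i j n y hj hn h1 h2
      exact ⟨y', .inl hy'⟩

/-- Matsumoto's theorem. -/
theorem prod_map_eq_of_isReducedWord {X : Type*} [Monoid X] (f : b.support → X)
    (hf : ∀ i j : b.support, i ≠ j →
      ((alternatingWord i j (orderOf (simpleRefl b i * simpleRefl b j))).map f).prod =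
        ((alternatingWord j i (orderOf (simpleRefl b i * simpleRefl b j))).map f).prod)
    (hfin : ∀ i j : b.support, 0 < orderOf (simpleRefl b i * simpleRefl b j))
    {u u' : List b.support} (hu : IsReducedWord b u) (hu' : IsReducedWord b u')
    (h : wordProd b u = wordProd b u') : (u.map f).prod = (u'.map f).prod := by
  have hlen : ∀ {u u' : List b.support}, IsReducedWord b u → IsReducedWord b u' →
      wordProd b u = wordProd b u' → u.length = u'.length := fun h1 h2 h3 => by
    rw [h1, h2, h3]
  induction hn : u.length generalizing u u' with
  | zero =>
    have := hlen hu hu' h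
    rw [List.length_eq_zero_iff.1 hn, List.length_eq_zero_iff.1 (this.symm.trans hn)]
  | succ n ih =>
    have hn' := (hlen hu hu' h).symm.trans hn
    obtain ⟨v, i, rfl⟩ := List.eq_nil_or_concat' u |>.resolve_left (by rintro rfl; simp at hn)
    obtain ⟨v', j, rfl⟩ := List.eq_nil_or_concat' u' |>.resolve_left (by rintro rfl; simp at hn')
    have cancel : ∀ {x y : List b.support} {k : b.support}, IsReducedWord b (x ++ [k]) →
        IsReducedWord b (y ++ [k]) → wordProd b (x ++ [k]) = wordProd b (y ++ [k]) →
        (x ++ [k]).length = n + 1 → ((x ++ [k]).map f).prod = ((y ++ [k]).map f).prod := by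
      intro x y k hx hy hxy hk
      have := ih hx.of_append_left hy.of_append_left (by simpa using hxy) (by simpa using hk)
      simp [this]
    by_cases hij : i = j
    · subst hij
      exact cancel hu hu' h hn
    · obtain ⟨m, hm⟩ : ∃ m, orderOf (simpleRefl b i * simpleRefl b j) = m + 1 :=
        ⟨_, (Nat.succ_pred_eq_of_pos (hfin i j)).symm⟩
      have hb := hf i j hij
      have hprod : wordProd b (alternatingWord i j (m + 1)) =
          wordProd b (alternatingWord j i (m + 1)) := by
        rw [wordProd_alternatingWord_swap j i, ← hm, pow_orderOf_eq_one, mul_one]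
      rw [hm] at hb
      -- Both `i` and `j` are right descents, so some `y` can be completed to a reduced word by
      -- either full alternating word. One completion ends in `i` like `u`, the other in `j` like
      -- `u'`; cancelling last letters settles these comparisons by induction, and the braid
      -- relation joins the two completions.
      obtain ⟨y, hy⟩ := exists_reducedWord_append_alternatingWord hu.not_isPos_of_concat
        (h ▸ hu'.not_isPos_of_concat) (m + 1) hm.ge
      have hy' : (wordProd b (y ++ alternatingWord i j (m + 1)) = wordProd b (v ++ [i]) ∧
          IsReducedWord b (y ++ alternatingWord i j (m + 1))) ∧
          (wordProd b (y ++ alternatingWord j i (m + 1)) = wordProd b (v ++ [i]) ∧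
          IsReducedWord b (y ++ alternatingWord j i (m + 1))) := by
        have e : wordProd b (y ++ alternatingWord i j (m + 1)) =
            wordProd b (y ++ alternatingWord j i (m + 1)) := by
          rw [wordProd_append, wordProd_append, hprod]
        simp only [IsReducedWord, List.length_append, CoxeterSystem.length_alternatingWord, e,
          or_self] at hy ⊢
        exact ⟨hy, hy⟩
      have e1 : y ++ alternatingWord j i (m + 1) = (y ++ alternatingWord i j m) ++ [i] := by
        simp [alternatingWord]
      have e2 : y ++ alternatingWord i j (m + 1) = (y ++ alternatingWord j i m) ++ [j] := by
        simp [alternatingWord]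
      have h1 := cancel hu (e1 ▸ hy'.2.2) (e1 ▸ hy'.2.1.symm) hn
      have h2 := cancel hu' (e2 ▸ hy'.1.2) (h.symm.trans (e2 ▸ hy'.1.1.symm)) hn'
      rw [h1, h2, ← e1, ← e2, List.map_append, List.map_append, List.prod_append,
        List.prod_append, hb]

end Matsumoto

/-! ### Yang–Baxter identities from the quadratic relations alone. -/

section YangBaxterEquation

variable {K E : Type*} [CommRing K] [Ring E] [Algebra K E] {a b : E} {S p : K}

/-- In this and the next three identities no braid relation is assumed: they show that scalar shifts
leave the braid defect unchanged. In use `S` is $t_1+t_2$, `p` is $t_1t_2$, and the conditions on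
the shifts come from `ybCoeff_add`. -/
lemma yangBaxter_two {c₁ c₂ : K} :
    (a + c₁ • (1 : E)) * (b + c₂ • (1 : E)) - (b + c₂ • (1 : E)) * (a + c₁ • (1 : E)) =
      a * b - b * a := by
  simp only [mul_add, add_mul, smul_mul_assoc, mul_smul_comm, mul_one, one_mul]
  module

lemma yangBaxter_three (ha : a * a = S • a - p • (1 : E)) (hb : b * b = S • b - p • (1 : E))
    {c₁ c₂ c₃ : K} (h : c₂ * (S + c₁ + c₃) = c₁ * c₃) :
    (a + c₁ • (1 : E)) * ((b + c₂ • (1 : E)) * (a + c₃ • (1 : E))) -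
        (b + c₃ • (1 : E)) * ((a + c₂ • (1 : E)) * (b + c₁ • (1 : E))) =
      a * (b * a) - b * (a * b) := by
  simp only [mul_add, add_mul, smul_mul_assoc, mul_smul_comm, mul_one, one_mul, ha, hb]
  match_scalars
  all_goals grind

lemma yangBaxter_four (ha : a * a = S • a - p • (1 : E)) (hb : b * b = S • b - p • (1 : E))
    {c₁ c₂ c₃ c₄ : K} (h₂ : c₂ * (S + c₁ + c₃) = c₁ * c₃) (h₃ : c₃ * (S + c₁ + c₄) = c₁ * c₄) :
    (a + c₁ • (1 : E)) * ((b + c₂ • (1 : E)) * ((a + c₃ • (1 : E)) * (b + c₄ • (1 : E)))) -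
        (b + c₄ • (1 : E)) * ((a + c₃ • (1 : E)) * ((b + c₂ • (1 : E)) * (a + c₁ • (1 : E)))) =
      a * (b * (a * b)) - b * (a * (b * a)) := by
  have ha' (x : E) : a * (a * x) = S • (a * x) - p • x := by
    rw [← mul_assoc, ha, sub_mul, smul_mul_assoc, smul_mul_assoc, one_mul]
  have hb' (x : E) : b * (b * x) = S • (b * x) - p • x := by
    rw [← mul_assoc, hb, sub_mul, smul_mul_assoc, smul_mul_assoc, one_mul]
  simp only [mul_add, add_mul, mul_sub, smul_mul_assoc, mul_smul_comm, mul_one, one_mul, ha, hb,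
    ha', hb']
  match_scalars
  all_goals grind

/-- The expression is homogeneous of degree four, with `p` of degree two; it is the obstruction at
words of length two in `yangBaxter_six`, where it occurs with either sign. -/
lemma yangBaxter_six_coeff {c₁ c₂ c₃ c₄ c₅ c₆ : K} (h₂ : c₂ * (S + c₁ + c₃) = c₁ * c₃)
    (h₃ : c₃ * (S + c₁ + c₅) = c₁ * c₅) (h₄ : c₄ * (S + c₃ + c₅) = c₃ * c₅)
    (h₄' : c₄ * (S + c₂ + c₆) = c₂ * c₆) :
        -(c₃ * p * S) - c₃ * p * c₁ - c₃ * p * c₅ - c₃ * S * c₁ * c₆ + c₃ * S * c₄ * c₂ + c₃ * S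
        * c₄ * c₅ + c₃ * S * c₂ * c₅ + c₃ * S * c₅ * c₆ + c₃ * S ^ 2 * c₅ + c₃ * c₁ * c₄ * c₂ -
        c₃ * c₁ * c₄ * c₆ - c₃ * c₁ * c₂ * c₆ + c₃ * c₄ * c₂ * c₅ + c₃ * c₄ * c₅ * c₆ + c₃ * c₂
        * c₅ * c₆ - p * S * c₄ + p * c₁ * c₅ - p * c₄ * c₂ - p * c₄ * c₆ + p * c₂ * c₆ + S * c₁
        * c₄ * c₂ - S * c₁ * c₄ * c₆ + S * c₁ * c₂ * c₅ + S * c₄ * c₂ * c₅ + S * c₂ * c₅ * c₆ +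
        S ^ 2 * c₄ * c₂ + S ^ 2 * c₂ * c₅ + c₁ * c₄ * c₂ * c₅ - c₁ * c₄ * c₅ * c₆ + c₁ * c₂ * c₅
        * c₆ = 0 := by
  linear_combination (S * c₅ + S * c₆ + 2 * c₅ * c₆) * h₂ +
    (S * c₄ + c₂ * c₄ - c₂ * c₆ + c₄ * c₆ - p) * h₃ -
    (S * S + S * c₁ + S * c₆ + 2 * c₁ * c₆) * h₄ +
    (S * S + S * c₁ + S * c₅ + 2 * c₁ * c₅ - p) * h₄'

lemma yangBaxter_six (ha : a * a = S • a - p • (1 : E)) (hb : b * b = S • b - p • (1 : E))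
    {c₁ c₂ c₃ c₄ c₅ c₆ : K} (h₂ : c₂ * (S + c₁ + c₃) = c₁ * c₃)
    (h₃ : c₃ * (S + c₁ + c₅) = c₁ * c₅) (h₄ : c₄ * (S + c₃ + c₅) = c₃ * c₅)
    (h₄' : c₄ * (S + c₂ + c₆) = c₂ * c₆) (h₅ : c₅ * (S + c₁ + c₆) = c₁ * c₆) :
    (a + c₁ • (1 : E)) * ((b + c₂ • (1 : E)) * ((a + c₃ • (1 : E)) *
        ((b + c₄ • (1 : E)) * ((a + c₅ • (1 : E)) * (b + c₆ • (1 : E)))))) -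
        (b + c₆ • (1 : E)) * ((a + c₅ • (1 : E)) * ((b + c₄ • (1 : E)) *
          ((a + c₃ • (1 : E)) * ((b + c₂ • (1 : E)) * (a + c₁ • (1 : E)))))) =
      a * (b * (a * (b * (a * b)))) - b * (a * (b * (a * (b * a)))) := by
  have ha' (x : E) : a * (a * x) = S • (a * x) - p • x := by
    rw [← mul_assoc, ha, sub_mul, smul_mul_assoc, smul_mul_assoc, one_mul]
  have hb' (x : E) : b * (b * x) = S • (b * x) - p • x := by
    rw [← mul_assoc, hb, sub_mul, smul_mul_assoc, smul_mul_assoc, one_mul]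
  simp only [mul_add, add_mul, mul_sub, smul_mul_assoc, mul_smul_comm, mul_one, one_mul, ha, hb,
    ha', hb', smul_sub, smul_add]
  have k := yangBaxter_six_coeff (p := p) h₂ h₃ h₄ h₄'
  match_scalars
  all_goals
    first
    | ring1
    | linear_combination h₂ + h₃ + h₄ + h₅
    | linear_combination -h₂ - h₃ - h₄ - h₅
    | linear_combination k
    | linear_combination -k

end YangBaxterEquation

/-! ### Identities among the coefficients. -/

section Coefficients

variable {Λ : Type*} [AddCommGroup Λ] [Module.Free ℤ Λ]

lemma expo_add (μ ν : Λ) : expo (μ + ν) = expo μ * expo ν := by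
  rw [expo, expo, expo, ← map_mul, AddMonoidAlgebra.single_mul_single, one_mul]

lemma expo_zero : expo (0 : Λ) = 1 := by
  rw [expo, ← map_one (algebraMap (AddMonoidAlgebra ℤ Λ) (LatticeField Λ))]
  rfl

lemma expo_mul_expo_neg (μ : Λ) : expo μ * expo (-μ) = 1 := by
  rw [← expo_add, add_neg_cancel, expo_zero]

lemma expo_ne_zero (μ : Λ) : expo μ ≠ 0 := left_ne_zero_of_mul_eq_one (expo_mul_expo_neg μ)

lemma expo_neg (μ : Λ) : expo (-μ) = (expo μ)⁻¹ := eq_inv_of_mul_eq_one_right (expo_mul_expo_neg μ)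

lemma expo_injective : Function.Injective (expo : Λ → LatticeField Λ) := fun μ ν h => by
  have := IsFractionRing.injective (AddMonoidAlgebra ℤ Λ) (LatticeField Λ) h
  exact Finsupp.single_left_injective one_ne_zero (congr_arg AddMonoidAlgebra.coeff this)

lemma expo_ne_one {μ : Λ} (h : μ ≠ 0) : expo μ ≠ 1 := fun h' =>
  h (expo_injective (h'.trans expo_zero.symm))

lemma constC_injective : Function.Injective (constC : LatticeField Λ →+* CoeffRing Λ) :=
  MvPolynomial.C_injective _ _

/-- The parameters satisfy `t₁ + t₂ x ≠ 0` for constant `x`. -/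
lemma t₁_add_ne_zero (x : LatticeField Λ) : t₁ Λ + t₂ Λ * constC x ≠ 0 := by
  intro h
  -- At $t_1=1$, $t_2=0$ the expression takes the value $1$.
  have h' : MvPolynomial.eval ![(1 : LatticeField Λ), 0]
      ((MvPolynomial.map (algebraMap ℤ (LatticeField Λ)) (MvPolynomial.X 0) +
        MvPolynomial.map (algebraMap ℤ (LatticeField Λ)) (MvPolynomial.X 1) * MvPolynomial.C x :
        MvPolynomial (Fin 2) (LatticeField Λ))) = 0 := by
    have h'' : (MvPolynomial.map (algebraMap ℤ (LatticeField Λ)) (MvPolynomial.X 0) +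
        MvPolynomial.map (algebraMap ℤ (LatticeField Λ)) (MvPolynomial.X 1) * MvPolynomial.C x :
        MvPolynomial (Fin 2) (LatticeField Λ)) = 0 := h
    rw [h'', map_zero]
  simp at h'

lemma coeffA_ne_zero {μ : Λ} (h : μ ≠ 0) : coeffA μ ≠ 0 := by
  refine mul_ne_zero (t₁_add_ne_zero _) ?_
  rw [Ne, map_eq_zero_iff _ constC_injective, inv_eq_zero, sub_eq_zero]
  exact (expo_ne_one h).symm

lemma coeffB_eq_neg_ybCoeff (μ : Λ) : coeffB μ = -ybCoeff μ := by
  rw [coeffB, ybCoeff, bigE, ← mul_neg, ← map_neg, ← inv_neg, neg_sub]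

/-- This is the trace of `dlOp b i` on the span of $w$ and $ws_i$, with $\mu = w\alpha_i$. -/
lemma coeffB_add_coeffB_neg {μ : Λ} (h : μ ≠ 0) : coeffB μ + coeffB (-μ) = t₁ Λ + t₂ Λ := by
  have h1 := expo_ne_one h
  have h0 := expo_ne_zero μ
  have : (1 - expo (-μ))⁻¹ + (1 - expo μ)⁻¹ = 1 := by
    rw [expo_neg]
    grind
  rw [coeffB, coeffB, neg_neg, ← mul_add, ← map_add, this, map_one, mul_one]

/-- Given the trace, this says that the same $2\times2$ block has determinant $t_1t_2$. -/
lemma coeffA_mul_coeffA_neg {μ : Λ} (h : μ ≠ 0) :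
    coeffA μ * coeffA (-μ) + coeffB μ * coeffB μ =
      (t₁ Λ + t₂ Λ) * coeffB μ - t₁ Λ * t₂ Λ := by
  have h1 := expo_ne_one h
  have h0 := expo_ne_zero μ
  obtain ⟨d, hd⟩ : ∃ d, d = (1 - expo μ)⁻¹ := ⟨_, rfl⟩
  have e1 : (1 - expo (-μ))⁻¹ = 1 - d := by
    rw [hd, expo_neg]
    grind
  have e2 : constC (expo μ) * constC d = constC d - 1 := by
    rw [← map_mul, ← map_one constC, ← map_sub]
    congr 1
    rw [hd]
    grind
  have e3 : constC (expo (-μ)) * (1 - constC d) = - constC d := by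
    rw [← map_one constC, ← map_sub, ← map_mul, ← map_neg]
    congr 1
    rw [hd, expo_neg]
    grind
  rw [coeffA, coeffA, coeffB, neg_neg, ← hd, e1, map_sub, map_one]
  linear_combination (t₂ Λ * (t₁ Λ + t₂ Λ * constC (expo (-μ)))) * (1 - constC d) * e2 +
    t₂ Λ * (t₁ Λ * constC d + t₂ Λ * (constC d - 1)) * e3

/-- Multiplicativity of $e^{-\mu} = E(\mu)+1$, rewritten in terms of inverses of $E$. -/
lemma ybCoeff_add {μ ν ρ : Λ} (hμ : μ ≠ 0) (hν : ν ≠ 0) (hρ : ρ ≠ 0) (h : ρ = μ + ν) :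
    ybCoeff ρ * (t₁ Λ + t₂ Λ + ybCoeff μ + ybCoeff ν) = ybCoeff μ * ybCoeff ν := by
  have key : (bigE ρ)⁻¹ * (1 + (bigE μ)⁻¹ + (bigE ν)⁻¹) = (bigE μ)⁻¹ * (bigE ν)⁻¹ := by
    have h1 : bigE μ ≠ 0 := sub_ne_zero.2 (expo_ne_one (neg_ne_zero.2 hμ))
    have h2 : bigE ν ≠ 0 := sub_ne_zero.2 (expo_ne_one (neg_ne_zero.2 hν))
    have h3 : bigE ρ ≠ 0 := sub_ne_zero.2 (expo_ne_one (neg_ne_zero.2 hρ))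
    have h4 : bigE ρ = (bigE μ + 1) * (bigE ν + 1) - 1 := by
      rw [h, bigE, bigE, bigE, neg_add, expo_add]
      ring
    field_simp
    rw [h4]
    ring
  have key' := congr_arg constC key
  simp only [map_mul, map_add, map_one] at key'
  simp only [ybCoeff]
  linear_combination (t₁ Λ + t₂ Λ) ^ 2 * key'

variable {G : Type*} [Group G] [DistribMulAction G Λ]

lemma fieldAct_expo (g : G) (μ : Λ) : fieldAct g (expo μ) = expo (g • μ) := by
  rw [fieldAct, expo, IsFractionRing.ringEquivOfRingEquiv_algebraMap]
  congr 1
  simp [AddMonoidAlgebra.mapDomainRingEquiv]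

lemma coeffAct_constC (g : G) (x : LatticeField Λ) :
    coeffAct g (constC x) = constC (fieldAct g x) :=
  MvPolynomial.map_C _ _

lemma coeffAct_algebraMap (g : G) (x : ParamRing) :
    coeffAct g (algebraMap ParamRing (CoeffRing Λ) x) = algebraMap ParamRing (CoeffRing Λ) x := by
  change MvPolynomial.map _ (MvPolynomial.map _ x) = MvPolynomial.map _ x
  rw [MvPolynomial.map_map]
  congr 1
  exact congr_arg _ (RingHom.ext_int _ _)

lemma coeffAct_coeffA (g : G) (μ : Λ) : coeffAct g (coeffA μ) = coeffA (g • μ) := by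
  simp only [coeffA, t₁, t₂, map_mul, map_add, map_sub, map_one, map_inv₀, coeffAct_constC,
    coeffAct_algebraMap, fieldAct_expo, smul_neg]

lemma coeffAct_coeffB (g : G) (μ : Λ) : coeffAct g (coeffB μ) = coeffB (g • μ) := by
  simp only [coeffB, t₁, t₂, map_mul, map_add, map_sub, map_one, map_inv₀, coeffAct_constC,
    coeffAct_algebraMap, fieldAct_expo, smul_neg]

end Coefficients

/-! ### Rank two root systems and the Demazure–Lusztig operators. -/

section DemazureLusztig

variable {ι Λ Λ' : Type*} [AddCommGroup Λ] [AddCommGroup Λ'] {P : RootDatum ι Λ Λ'} (b : P.Base)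

open CoxeterSystem (alternatingWord)

lemma simpleRefl_smul (i : b.support) (x : Λ) :
    simpleRefl b i • x = x - P.toLinearMap x (P.coroot i) • P.root i := by
  change P.reflection i x = _
  rw [RootPairing.reflection_apply]
  rfl

lemma simpleRefl_smul_self (i : b.support) :
    simpleRefl b i • P.root i = -P.root i := by
  change P.reflection i (P.root i) = _
  simp

lemma simpleRefl_smul_root (i j : b.support) :
    simpleRefl b i • P.root j = P.root j - P.pairing j i • P.root i := by
  rw [simpleRefl_smul, P.root_coroot_eq_pairing]

lemma smul_root_ne_zero (w : P.weylGroup) (k : ι) : w • P.root k ≠ 0 := by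
  rw [P.weylGroup_apply_root]
  exact P.ne_zero _

/-- The type of the rank two root system spanned by two simple roots: the action of the simple
reflections and the order of their product. -/
inductive RankTwo (i j : b.support) : Prop
  | a1a1 (h₁ : simpleRefl b i • P.root j = P.root j) (h₂ : simpleRefl b j • P.root i = P.root i)
      (h : orderOf (simpleRefl b i * simpleRefl b j) = 2)
  | a2 (h₁ : simpleRefl b i • P.root j = P.root i + P.root j)
      (h₂ : simpleRefl b j • P.root i = P.root i + P.root j)
      (h : orderOf (simpleRefl b i * simpleRefl b j) = 3)
  | b2 (h₁ : simpleRefl b i • P.root j = 2 • P.root i + P.root j)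
      (h₂ : simpleRefl b j • P.root i = P.root i + P.root j)
      (h : orderOf (simpleRefl b i * simpleRefl b j) = 4)
  | g2 (h₁ : simpleRefl b i • P.root j = 3 • P.root i + P.root j)
      (h₂ : simpleRefl b j • P.root i = P.root i + P.root j)
      (h : orderOf (simpleRefl b i * simpleRefl b j) = 6)

lemma eq_zero_of_smul_root_add {i j : b.support} (hij : i ≠ j) {m n : ℤ}
    (h : m • P.root i + n • P.root j = 0) : m = 0 ∧ n = 0 :=
  LinearIndependent.pair_iff.1 (b.linearIndependent_pair_of_ne hij) m n h

lemma exists_simpleRefl_mul_smul (i j : b.support) (x : Λ) :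
    ∃ m n : ℤ, (simpleRefl b i * simpleRefl b j) • x = x + m • P.root i + n • P.root j := by
  refine ⟨-P.toLinearMap (x - P.toLinearMap x (P.coroot j) • P.root j) (P.coroot i),
    -P.toLinearMap x (P.coroot j), ?_⟩
  rw [mul_smul, simpleRefl_smul b j, simpleRefl_smul b i]
  module

section OrderOf

variable {G A : Type*} [Group G] [AddCommGroup A] [DistribMulAction G A] [FaithfulSMul G A]
  {g : G} {u v : A}

/-- An element acting with finite order on a lattice of rank two, and trivially on the quotient by
this lattice, has the same order on the whole group. -/
lemma orderOf_eq_two_of_smul (hx : ∀ x : A, ∃ m n : ℤ, g • x = x + m • u + n • v)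
    (hu : g • u = -u) (hv : g • v = -v) (hne : ∀ m n : ℤ, m • u + n • v = 0 → m = 0 ∧ n = 0) :
    orderOf g = 2 := by
  refine orderOf_eq_prime (eq_of_smul_eq_smul fun x : A => ?_) fun h => ?_
  -- Here $g^k x = x + (1+g+\dots+g^{k-1})(mu+nv)$, and the sum of powers vanishes on the span of
  -- $u$ and $v$. The same argument gives orders three, four and six.
  · obtain ⟨m, n, h⟩ := hx x
    simp only [pow_succ, pow_zero, one_mul, mul_smul, one_smul, h, smul_add, smul_comm g, hu, hv]
    module
  · have h' := hne (-2) 0 (by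
      rw [h, one_smul] at hu
      rw [zero_smul, add_zero]
      nth_rw 1 [neg_smul, two_smul, hu]
      simp)
    lia

lemma orderOf_eq_three_of_smul (hx : ∀ x : A, ∃ m n : ℤ, g • x = x + m • u + n • v)
    (hu : g • u = v) (hv : g • v = -u - v)
    (hne : ∀ m n : ℤ, m • u + n • v = 0 → m = 0 ∧ n = 0) : orderOf g = 3 := by
  refine orderOf_eq_prime (eq_of_smul_eq_smul fun x : A => ?_) fun h => ?_
  · obtain ⟨m, n, h⟩ := hx x
    simp only [pow_succ, pow_zero, one_mul, mul_smul, one_smul, h, smul_add, smul_sub, smul_neg,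
      smul_comm g, hu, hv]
    module
  · have h' := hne 1 (-1) (by
      rw [h, one_smul] at hu
      rw [hu]
      module)
    lia

lemma orderOf_eq_four_of_smul (hx : ∀ x : A, ∃ m n : ℤ, g • x = x + m • u + n • v)
    (hu : g • u = u + v) (hv : g • v = -(2 : ℤ) • u - v)
    (hne : ∀ m n : ℤ, m • u + n • v = 0 → m = 0 ∧ n = 0) : orderOf g = 4 := by
  refine orderOf_eq_prime_pow (p := 2) (n := 1) (fun h => ?_)
    (eq_of_smul_eq_smul fun x : A => ?_)
  · have h1 : g ^ 2 • u = -u := by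
      simp only [pow_succ, pow_zero, one_mul, mul_smul, smul_add, hu, hv]
      module
    have h' := hne 2 0 (by
      rw [pow_one] at h
      rw [h, one_smul] at h1
      rw [two_smul]
      nth_rw 1 [h1]
      module)
    lia
  · obtain ⟨m, n, h⟩ := hx x
    norm_num only
    simp only [pow_succ, pow_zero, one_mul, mul_smul, one_smul, h, smul_add, smul_sub,
      smul_comm g, hu, hv]
    module

lemma orderOf_eq_six_of_smul (hx : ∀ x : A, ∃ m n : ℤ, g • x = x + m • u + n • v)
    (hu : g • u = (2 : ℤ) • u + v) (hv : g • v = -(3 : ℤ) • u - v)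
    (hne : ∀ m n : ℤ, m • u + n • v = 0 → m = 0 ∧ n = 0) : orderOf g = 6 := by
  have h2 : g ^ 2 • u = u + v := by
    simp only [pow_succ, pow_zero, one_mul, mul_smul, smul_add, smul_comm g, hu, hv]
    module
  have h3 : g ^ 3 • u = -u := by
    rw [pow_succ', mul_smul, h2, smul_add, hu, hv]
    module
  have h2' : g ^ 2 ≠ 1 := fun h => by
    rw [h, one_smul] at h2
    have h' := hne 0 1 (by simpa using h2)
    lia
  have h3' : g ^ 3 ≠ 1 := fun h => by
    rw [h, one_smul] at h3
    have h' := hne 2 0 (by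
      rw [two_smul]
      nth_rw 1 [h3]
      module)
    lia
  have h6 : g ^ 6 = 1 := eq_of_smul_eq_smul fun x : A => by
    obtain ⟨m, n, h⟩ := hx x
    simp only [pow_succ, pow_zero, one_mul, mul_smul, one_smul, h, smul_add, smul_sub,
      smul_comm g, hu, hv]
    module
  refine orderOf_eq_of_pow_and_pow_div_prime (by lia) h6 fun p hp hd => ?_
  have : p ∣ 2 * 3 := hd
  rcases hp.dvd_mul.1 this with h | h
  · rw [(Nat.prime_dvd_prime_iff_eq hp Nat.prime_two).1 h]
    exact h3'
  · rw [(Nat.prime_dvd_prime_iff_eq hp Nat.prime_three).1 h]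
    exact h2'

end OrderOf

instance faithfulSMul_weylGroup : FaithfulSMul P.weylGroup Λ := ⟨weylGroup_ext⟩

lemma rankTwo_of_pairing {i j : b.support} (hij : i ≠ j)
    (h : (P.pairing j i = 0 ∧ P.pairing i j = 0) ∨ (P.pairing j i = -1 ∧ P.pairing i j = -1) ∨
      (P.pairing j i = -2 ∧ P.pairing i j = -1) ∨ (P.pairing j i = -3 ∧ P.pairing i j = -1)) :
    RankTwo b i j := by
  have h0 := simpleRefl_smul_self b i
  have h0' := simpleRefl_smul_self b j
  have h1 := simpleRefl_smul_root b i j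
  have h2 := simpleRefl_smul_root b j i
  have hx := exists_simpleRefl_mul_smul b i j
  have hne : ∀ m n : ℤ, m • P.root i + n • P.root j = 0 → m = 0 ∧ n = 0 := fun m n =>
    eq_zero_of_smul_root_add b hij
  have hj : (simpleRefl b i * simpleRefl b j) • P.root j =
      -P.root j + P.pairing j i • P.root i := by
    rw [mul_smul, h0', smul_neg, h1]
    module
  have hi : (simpleRefl b i * simpleRefl b j) • P.root i =
      -P.root i - P.pairing i j • P.root j +
        (P.pairing i j * P.pairing j i) • P.root i := by
    rw [mul_smul, h2, smul_sub, smul_comm, h0, h1]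
    module
  rcases h with ⟨e, e'⟩ | ⟨e, e'⟩ | ⟨e, e'⟩ | ⟨e, e'⟩ <;> rw [e] at h1 hj <;> rw [e'] at h2 <;>
    rw [e, e'] at hi
  · exact .a1a1 (h1.trans (by module)) (h2.trans (by module))
      (orderOf_eq_two_of_smul hx (hi.trans (by module)) (hj.trans (by module)) hne)
  · exact .a2 (h1.trans (by module)) (h2.trans (by module))
      (orderOf_eq_three_of_smul hx (hi.trans (by module)) (hj.trans (by module)) hne)
  · exact .b2 (h1.trans (by module)) (h2.trans (by module))
      (orderOf_eq_four_of_smul hx (hi.trans (by module)) (hj.trans (by module)) hne)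
  · exact .g2 (h1.trans (by module)) (h2.trans (by module))
      (orderOf_eq_six_of_smul hx (hi.trans (by module)) (hj.trans (by module)) hne)

/-- Pairings of distinct simple roots are nonpositive, which leaves the four classical types. Types
$B_2$ and $G_2$ are recorded with $\alpha_i$ short, hence the two orders. -/
lemma rankTwo_or [Finite ι] [P.IsReduced] {i j : b.support} (hij : i ≠ j) :
    RankTwo b i j ∨ RankTwo b j i := by
  have hne : (i : ι) ≠ j := fun h => hij (Subtype.ext h)
  have hle := b.pairingIn_le_zero_of_ne hne i.2 j.2
  have hle' := b.pairingIn_le_zero_of_ne hne.symm j.2 i.2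
  have hmem := P.pairingIn_pairingIn_mem_set_of_isCrystal_of_isRed' i j
    (fun h => hne (P.root.injective h)) (b.root_ne_neg_of_ne i.2 j.2 hne)
  have e1 : P.pairingIn ℤ i j = P.pairing i j := by simpa using P.algebraMap_pairingIn ℤ i j
  have e2 : P.pairingIn ℤ j i = P.pairing j i := by simpa using P.algebraMap_pairingIn ℤ j i
  rw [e1] at hle hmem
  rw [e2] at hle' hmem
  simp only [Set.mem_insert_iff, Set.mem_singleton_iff, Prod.mk.injEq] at hmem
  have h : ((P.pairing j i = 0 ∧ P.pairing i j = 0) ∨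
      (P.pairing j i = -1 ∧ P.pairing i j = -1) ∨ (P.pairing j i = -2 ∧ P.pairing i j = -1) ∨
      (P.pairing j i = -3 ∧ P.pairing i j = -1)) ∨
      ((P.pairing i j = 0 ∧ P.pairing j i = 0) ∨
      (P.pairing i j = -1 ∧ P.pairing j i = -1) ∨ (P.pairing i j = -2 ∧ P.pairing j i = -1) ∨
      (P.pairing i j = -3 ∧ P.pairing j i = -1)) := by lia
  exact h.imp (rankTwo_of_pairing b hij) (rankTwo_of_pairing b hij.symm)

lemma orderOf_simpleRefl_mul_comm (i j : b.support) :
    orderOf (simpleRefl b i * simpleRefl b j) = orderOf (simpleRefl b j * simpleRefl b i) := by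
  rw [← orderOf_inv, mul_inv_rev, inv_eq_of_mul_eq_one_left (simpleRefl_mul_self b i),
    inv_eq_of_mul_eq_one_left (simpleRefl_mul_self b j)]

lemma RankTwo.orderOf_pos {i j : b.support} (h : RankTwo b i j) :
    0 < orderOf (simpleRefl b i * simpleRefl b j) := by
  rcases h with ⟨_, _, h⟩ | ⟨_, _, h⟩ | ⟨_, _, h⟩ | ⟨_, _, h⟩ <;> lia

lemma orderOf_simpleRefl_mul_pos [Finite ι] [P.IsReduced] (i j : b.support) :
    0 < orderOf (simpleRefl b i * simpleRefl b j) := by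
  by_cases hij : i = j
  · rw [hij, simpleRefl_mul_self, orderOf_one]
    exact one_pos
  · rcases rankTwo_or b hij with h | h
    · exact h.orderOf_pos
    · rw [orderOf_simpleRefl_mul_comm]
      exact h.orderOf_pos

/-- The operator on the free module on the Weyl group describing right multiplication by the
Demazure–Lusztig element of `i`. -/
def dlOp [Module.Free ℤ Λ] (i : b.support) :
    Module.End (CoeffRing Λ) (P.weylGroup →₀ CoeffRing Λ) :=
  Finsupp.linearCombination (CoeffRing Λ) fun w : P.weylGroup =>
    Finsupp.single (w * simpleRefl b i) (coeffA (w • P.root i)) +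
      Finsupp.single w (coeffB (w • P.root i))

variable [Module.Free ℤ Λ]

lemma dlOp_single (i : b.support) (w : P.weylGroup) (c : CoeffRing Λ) :
    dlOp b i (Finsupp.single w c) =
      Finsupp.single (w * simpleRefl b i) (c * coeffA (w • P.root i)) +
        Finsupp.single w (c * coeffB (w • P.root i)) := by
  simp [dlOp, Finsupp.linearCombination_single]

/-- The shift cancels the diagonal term, by `coeffB_eq_neg_ybCoeff`. This makes Yang–Baxter elements
act monomially. -/
lemma dlOp_add_ybCoeff_single (i : b.support) {w : P.weylGroup} {x : Λ} (h : w • P.root i = x)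
    (c : CoeffRing Λ) :
    (dlOp b i + ybCoeff x • (1 : Module.End (CoeffRing Λ) (P.weylGroup →₀ CoeffRing Λ)))
        (Finsupp.single w c) =
      Finsupp.single (w * simpleRefl b i) (c * coeffA x) := by
  rw [LinearMap.add_apply, dlOp_single, h, LinearMap.smul_apply, Module.End.one_apply,
    Finsupp.smul_single, add_assoc, ← Finsupp.single_add, coeffB_eq_neg_ybCoeff]
  simp [mul_comm]

/-- Cayley–Hamilton on each block spanned by $w$ and $ws_i$. -/
lemma dlOp_mul_self (i : b.support) :
    dlOp b i * dlOp b i = (t₁ Λ + t₂ Λ) • dlOp b i -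
      (t₁ Λ * t₂ Λ) • (1 : Module.End (CoeffRing Λ) (P.weylGroup →₀ CoeffRing Λ)) := by
  refine Finsupp.lhom_ext' fun w => LinearMap.ext_ring ?_
  have hne := smul_root_ne_zero (P := P) w i
  have hw : (w * simpleRefl b i) • P.root i = -(w • P.root i) := by
    rw [mul_smul, simpleRefl_smul_self, smul_neg]
  have hww : w * simpleRefl b i * simpleRefl b i = w := by
    rw [mul_assoc, simpleRefl_mul_self, mul_one]
  simp only [LinearMap.comp_apply, Finsupp.lsingle_apply, Module.End.mul_apply, dlOp_single,
    map_add, hw, hww, LinearMap.sub_apply, LinearMap.smul_apply, Module.End.one_apply, one_mul,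
    Finsupp.smul_single, smul_add, smul_eq_mul, mul_one]
  have k1 := coeffB_add_coeffB_neg hne
  have k2 := coeffA_mul_coeffA_neg hne
  have k3 : coeffA (w • P.root i) * coeffB (-(w • P.root i)) =
      (t₁ Λ + t₂ Λ) * coeffA (w • P.root i) - coeffB (w • P.root i) * coeffA (w • P.root i) := by
    linear_combination coeffA (w • P.root i) * k1
  have k4 : coeffB (w • P.root i) * coeffB (w • P.root i) =
      (t₁ Λ + t₂ Λ) * coeffB (w • P.root i) - t₁ Λ * t₂ Λ -
        coeffA (w • P.root i) * coeffA (-(w • P.root i)) := by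
    linear_combination k2
  rw [k3, k4]
  simp only [Finsupp.single_sub]
  abel

end DemazureLusztig

/-! ### The braid relations and the representation of the Hecke algebra. -/

section Representation

variable {ι Λ Λ' : Type*} [AddCommGroup Λ] [AddCommGroup Λ'] {P : RootDatum ι Λ Λ'} (b : P.Base)
  [Module.Free ℤ Λ]

open CoxeterSystem (alternatingWord)

/-- `dlOp` in the opposite of the endomorphism ring, so that words are applied from left to
right. -/
def dlElt (i : b.support) : (Module.End (CoeffRing Λ) (P.weylGroup →₀ CoeffRing Λ))ᵐᵒᵖ :=
  .op (dlOp b i)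

lemma dlElt_mul_self (i : b.support) :
    dlElt b i * dlElt b i = (t₁ Λ + t₂ Λ) • dlElt b i - (t₁ Λ * t₂ Λ) •
      (1 : (Module.End (CoeffRing Λ) (P.weylGroup →₀ CoeffRing Λ))ᵐᵒᵖ) :=
  MulOpposite.unop_injective (dlOp_mul_self b i)

lemma unop_dlElt_add_mul_single (i : b.support) {w : P.weylGroup} {x : Λ}
    (h : w • P.root i = x)
    (y : (Module.End (CoeffRing Λ) (P.weylGroup →₀ CoeffRing Λ))ᵐᵒᵖ) (c : CoeffRing Λ) :
    ((dlElt b i + ybCoeff x • (1 : (Module.End (CoeffRing Λ)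
        (P.weylGroup →₀ CoeffRing Λ))ᵐᵒᵖ)) * y).unop (Finsupp.single w c) =
      y.unop (Finsupp.single (w * simpleRefl b i) (c * coeffA x)) := by
  rw [MulOpposite.unop_mul, Module.End.mul_apply]
  exact congr_arg _ (dlOp_add_ybCoeff_single b i h c)

lemma unop_dlElt_add_single (i : b.support) {w : P.weylGroup} {x : Λ}
    (h : w • P.root i = x) (c : CoeffRing Λ) :
    (dlElt b i + ybCoeff x • (1 : (Module.End (CoeffRing Λ)
        (P.weylGroup →₀ CoeffRing Λ))ᵐᵒᵖ)).unop (Finsupp.single w c) =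
      Finsupp.single (w * simpleRefl b i) (c * coeffA x) :=
  dlOp_add_ybCoeff_single b i h c

/-- The comparison elements may depend on `w`; they will be products with shifts adapted to `w`. -/
lemma eq_of_forall_unop_single_eq
    {x y : (Module.End (CoeffRing Λ) (P.weylGroup →₀ CoeffRing Λ))ᵐᵒᵖ}
    (h : ∀ w : P.weylGroup, ∃ x' y' : (Module.End (CoeffRing Λ) (P.weylGroup →₀ CoeffRing Λ))ᵐᵒᵖ,
      x' - y' = x - y ∧
        x'.unop (Finsupp.single w 1) = y'.unop (Finsupp.single w 1)) : x = y := by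
  refine MulOpposite.unop_injective (Finsupp.lhom_ext' fun w => LinearMap.ext_ring ?_)
  obtain ⟨x', y', h1, h2⟩ := h w
  have h3 := congr_arg (fun z => z.unop (Finsupp.single w (1 : CoeffRing Λ))) h1
  simp only [MulOpposite.unop_sub, LinearMap.sub_apply, h2, sub_self] at h3
  exact (sub_eq_zero.1 h3.symm)

/-- At a basis vector $w$, each factor is shifted by `ybCoeff` of the root it meets. The two
alternating words meet the same roots in opposite orders, so both shifted products send $w$ to the
same multiple of the same vector; the Yang–Baxter identities then remove the shifts. -/
lemma RankTwo.dlElt_braid {i j : b.support} (h : RankTwo b i j) :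
    ((alternatingWord i j (orderOf (simpleRefl b i * simpleRefl b j))).map (dlElt b)).prod =
      ((alternatingWord j i (orderOf (simpleRefl b i * simpleRefl b j))).map (dlElt b)).prod := by
  have e0 := simpleRefl_smul_self b i
  have e0' := simpleRefl_smul_self b j
  have hi := dlElt_mul_self b i
  have hj := dlElt_mul_self b j
  have hw := wordProd_alternatingWord_swap j i (orderOf (simpleRefl b i * simpleRefl b j))
  rw [pow_orderOf_eq_one, mul_one] at hw
  rcases h with ⟨h₁, h₂, h⟩ | ⟨h₁, h₂, h⟩ | ⟨h₁, h₂, h⟩ | ⟨h₁, h₂, h⟩ <;> rw [h] at hw ⊢ <;>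
    simp only [alternatingWord, List.concat_eq_append, List.nil_append, List.cons_append,
      wordProd_cons, wordProd_nil, mul_one, List.map_cons, List.map_nil, List.prod_cons,
      List.prod_nil] at hw ⊢ <;>
    refine eq_of_forall_unop_single_eq fun w => ?_ <;>
    obtain ⟨x, hx⟩ : ∃ x, w • P.root i = x := ⟨_, rfl⟩ <;>
    obtain ⟨y, hy⟩ : ∃ y, w • P.root j = y := ⟨_, rfl⟩ <;>
    have hx0 : x ≠ 0 := hx ▸ smul_root_ne_zero w i <;>
    have hy0 : y ≠ 0 := hy ▸ smul_root_ne_zero w j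
  · refine ⟨_, _, yangBaxter_two (a := dlElt b i) (b := dlElt b j) (c₁ := ybCoeff x) (c₂ := ybCoeff y), ?_⟩
    rw [unop_dlElt_add_mul_single b i hx, unop_dlElt_add_single b j (x := y),
      unop_dlElt_add_mul_single b j hy, unop_dlElt_add_single b i (x := x), mul_assoc, hw,
      ← mul_assoc]
    · exact congr_arg _ (by ring)
    all_goals simp only [mul_smul, h₁, h₂, hx, hy]
  · have a1 : (w * simpleRefl b j) • P.root i = x + y := by
      simp only [mul_smul, h₂, smul_add, hx, hy]
    have a2 : (w * simpleRefl b j * simpleRefl b i) • P.root j = x := by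
      rw [mul_smul, h₁, smul_add, a1, mul_smul, e0', smul_neg, hy]
      module
    have b1 : (w * simpleRefl b i) • P.root j = x + y := by
      simp only [mul_smul, h₁, smul_add, hx, hy]
    have b2 : (w * simpleRefl b i * simpleRefl b j) • P.root i = y := by
      rw [mul_smul, h₂, smul_add, b1, mul_smul, e0, smul_neg, hx]
      module
    have n1 : x + y ≠ 0 := a1 ▸ smul_root_ne_zero _ _
    -- Alternating words are named by their last letter; in odd length `alternatingWord i j` also
    -- begins with `j`, so `i` and `j` trade places here.
    refine ⟨_, _, yangBaxter_three (a := dlElt b j) (b := dlElt b i) hj hi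
      (c₁ := ybCoeff y) (c₂ := ybCoeff (x + y))
      (c₃ := ybCoeff x) (ybCoeff_add hy0 hx0 n1 (add_comm _ _)), ?_⟩
    rw [unop_dlElt_add_mul_single b j hy, unop_dlElt_add_mul_single b i a1,
      unop_dlElt_add_single b j a2, unop_dlElt_add_mul_single b i hx,
      unop_dlElt_add_mul_single b j b1, unop_dlElt_add_single b i b2]
    simp only [mul_assoc, hw]
    exact congr_arg _ (by ring)
  -- The roots met are $x, 2x+y, x+y, y$ along one word and the reverse along the other.
  · have a1 : (w * simpleRefl b i) • P.root j = 2 • x + y := by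
      simp only [mul_smul, h₁, smul_add, smul_comm w, hx, hy]
    have a2 : (w * simpleRefl b i * simpleRefl b j) • P.root i = x + y := by
      simp only [mul_smul, h₁, h₂, e0, smul_add, smul_neg, smul_comm w, hx, hy]
      module
    have a3 : (w * simpleRefl b i * simpleRefl b j * simpleRefl b i) • P.root j = y := by
      rw [mul_smul, h₁, smul_add, smul_comm, a2, mul_smul, e0', smul_neg, a1]
      module
    have b1 : (w * simpleRefl b j) • P.root i = x + y := by
      simp only [mul_smul, h₂, smul_add, hx, hy]
    have b2 : (w * simpleRefl b j * simpleRefl b i) • P.root j = 2 • x + y := by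
      rw [mul_smul, h₁, smul_add, smul_comm, b1, mul_smul, e0', smul_neg, hy]
      module
    have b3 : (w * simpleRefl b j * simpleRefl b i * simpleRefl b j) • P.root i = x := by
      rw [mul_smul, h₂, smul_add, b2, mul_smul, e0, smul_neg, b1]
      module
    have n1 : x + y ≠ 0 := b1 ▸ smul_root_ne_zero _ _
    have n2 : 2 • x + y ≠ 0 := a1 ▸ smul_root_ne_zero _ _
    refine ⟨_, _, yangBaxter_four (a := dlElt b i) (b := dlElt b j) hi hj
      (c₁ := ybCoeff x) (c₂ := ybCoeff (2 • x + y))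
      (c₃ := ybCoeff (x + y)) (c₄ := ybCoeff y) (ybCoeff_add hx0 n1 n2 (by module))
      (ybCoeff_add hx0 hy0 n1 rfl), ?_⟩
    rw [unop_dlElt_add_mul_single b i hx, unop_dlElt_add_mul_single b j a1,
      unop_dlElt_add_mul_single b i a2, unop_dlElt_add_single b j a3,
      unop_dlElt_add_mul_single b j hy, unop_dlElt_add_mul_single b i b1,
      unop_dlElt_add_mul_single b j b2, unop_dlElt_add_single b i b3]
    simp only [mul_assoc, hw]
    exact congr_arg _ (by ring)
  · have a1 : (w * simpleRefl b i) • P.root j = 3 • x + y := by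
      simp only [mul_smul, h₁, smul_add, smul_comm w, hx, hy]
    have a2 : (w * simpleRefl b i * simpleRefl b j) • P.root i = 2 • x + y := by
      rw [mul_smul, h₂, smul_add, a1, mul_smul, e0, smul_neg, hx]
      module
    have a3 : (w * simpleRefl b i * simpleRefl b j * simpleRefl b i) • P.root j =
        3 • x + 2 • y := by
      rw [mul_smul, h₁, smul_add, smul_comm, a2, mul_smul, e0', smul_neg, a1]
      module
    have a4 : (w * simpleRefl b i * simpleRefl b j * simpleRefl b i * simpleRefl b j) •
        P.root i = x + y := by
      rw [mul_smul, h₂, smul_add, a3, mul_smul, e0, smul_neg, a2]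
      module
    have a5 : (w * simpleRefl b i * simpleRefl b j * simpleRefl b i * simpleRefl b j *
        simpleRefl b i) • P.root j = y := by
      rw [mul_smul, h₁, smul_add, smul_comm, a4, mul_smul, e0', smul_neg, a3]
      module
    have b1 : (w * simpleRefl b j) • P.root i = x + y := by
      simp only [mul_smul, h₂, smul_add, hx, hy]
    have b2 : (w * simpleRefl b j * simpleRefl b i) • P.root j = 3 • x + 2 • y := by
      rw [mul_smul, h₁, smul_add, smul_comm, b1, mul_smul, e0', smul_neg, hy]
      module
    have b3 : (w * simpleRefl b j * simpleRefl b i * simpleRefl b j) • P.root i = 2 • x + y := by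
      rw [mul_smul, h₂, smul_add, b2, mul_smul, e0, smul_neg, b1]
      module
    have b4 : (w * simpleRefl b j * simpleRefl b i * simpleRefl b j * simpleRefl b i) •
        P.root j = 3 • x + y := by
      rw [mul_smul, h₁, smul_add, smul_comm, b3, mul_smul, e0', smul_neg, b2]
      module
    have b5 : (w * simpleRefl b j * simpleRefl b i * simpleRefl b j * simpleRefl b i *
        simpleRefl b j) • P.root i = x := by
      rw [mul_smul, h₂, smul_add, b4, mul_smul, e0, smul_neg, b3]
      module
    have n1 : x + y ≠ 0 := b1 ▸ smul_root_ne_zero _ _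
    have n2 : 2 • x + y ≠ 0 := a2 ▸ smul_root_ne_zero _ _
    have n3 : 3 • x + y ≠ 0 := a1 ▸ smul_root_ne_zero _ _
    have n4 : 3 • x + 2 • y ≠ 0 := a3 ▸ smul_root_ne_zero _ _
    refine ⟨_, _, yangBaxter_six (a := dlElt b i) (b := dlElt b j) hi hj
      (c₁ := ybCoeff x) (c₂ := ybCoeff (3 • x + y))
      (c₃ := ybCoeff (2 • x + y)) (c₄ := ybCoeff (3 • x + 2 • y)) (c₅ := ybCoeff (x + y))
      (c₆ := ybCoeff y) (ybCoeff_add hx0 n2 n3 (by module)) (ybCoeff_add hx0 n1 n2 (by module))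
      (ybCoeff_add n2 n1 n4 (by module)) (ybCoeff_add n3 hy0 n4 (by module))
      (ybCoeff_add hx0 hy0 n1 rfl), ?_⟩
    rw [unop_dlElt_add_mul_single b i hx, unop_dlElt_add_mul_single b j a1,
      unop_dlElt_add_mul_single b i a2, unop_dlElt_add_mul_single b j a3,
      unop_dlElt_add_mul_single b i a4, unop_dlElt_add_single b j a5,
      unop_dlElt_add_mul_single b j hy, unop_dlElt_add_mul_single b i b1,
      unop_dlElt_add_mul_single b j b2, unop_dlElt_add_mul_single b i b3,
      unop_dlElt_add_mul_single b j b4, unop_dlElt_add_single b i b5]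
    simp only [mul_assoc, hw]
    exact congr_arg _ (by ring)

variable [Finite ι] [P.IsReduced]

lemma dlElt_braid {i j : b.support} (hij : i ≠ j) :
    ((alternatingWord i j (orderOf (simpleRefl b i * simpleRefl b j))).map (dlElt b)).prod =
      ((alternatingWord j i (orderOf (simpleRefl b i * simpleRefl b j))).map (dlElt b)).prod := by
  rcases rankTwo_or b hij with h | h
  · exact h.dlElt_braid
  · rw [orderOf_simpleRefl_mul_comm]
    exact h.dlElt_braid.symm

/-- The homomorphism from the Hecke algebra to operators given by Demazure–Lusztig elements. -/
def heckeHom : Hecke b →ₐ[ParamRing]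
    (Module.End (CoeffRing Λ) (P.weylGroup →₀ CoeffRing Λ))ᵐᵒᵖ :=
  RingQuot.liftAlgHom ParamRing ⟨FreeAlgebra.lift ParamRing (dlElt b), fun x y h => by
    induction h with
    | quadratic i =>
      have h₁ : algebraMap ParamRing (Module.End (CoeffRing Λ)
          (P.weylGroup →₀ CoeffRing Λ))ᵐᵒᵖ (MvPolynomial.X 0) = t₁ Λ • 1 :=
        (Algebra.algebraMap_eq_smul_one _).trans (algebraMap_smul (CoeffRing Λ) _ _).symm
      have h₂ : algebraMap ParamRing (Module.End (CoeffRing Λ)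
          (P.weylGroup →₀ CoeffRing Λ))ᵐᵒᵖ (MvPolynomial.X 1) = t₂ Λ • 1 :=
        (Algebra.algebraMap_eq_smul_one _).trans (algebraMap_smul (CoeffRing Λ) _ _).symm
      simp only [map_mul, map_sub, FreeAlgebra.lift_ι_apply, AlgHom.commutes, map_zero, h₁, h₂,
        sub_mul, mul_sub, dlElt_mul_self, smul_mul_assoc, mul_smul_comm, one_mul, mul_one]
      module
    | braid i j hij =>
      simp only [map_list_prod, List.map_map, Function.comp_def, FreeAlgebra.lift_ι_apply]
      exact dlElt_braid b hij⟩

lemma heckeHom_hgen (i : b.support) : heckeHom b (hgen b i) = dlElt b i :=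
  (RingQuot.liftAlgHom_mkAlgHom_apply _ _ _ _).trans (FreeAlgebra.lift_ι_apply _ _)

/-- The extension of `heckeHom` to `HeckeQ`. -/
def heckeQHom : HeckeQ b →ₐ[CoeffRing Λ]
    (Module.End (CoeffRing Λ) (P.weylGroup →₀ CoeffRing Λ))ᵐᵒᵖ :=
  Algebra.TensorProduct.lift (Algebra.ofId _ _) (heckeHom b) fun x _ => Algebra.commute_algebraMap_left x _

lemma heckeQHom_gen (i : b.support) : heckeQHom b (gen b i) = dlElt b i := by
  refine (Algebra.TensorProduct.lift_tmul _ _ _ _ _).trans ?_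
  rw [map_one, one_mul, heckeHom_hgen]

end Representation

/-! ### Action of Yang–Baxter elements and expansion over subwords. -/

section Expansion

variable {ι Λ Λ' : Type*} [AddCommGroup Λ] [AddCommGroup Λ'] {P : RootDatum ι Λ Λ'} (b : P.Base)

open CoxeterSystem (alternatingWord)

lemma subwordProd_zero (u : List b.support) (ε : Fin u.length → Fin 2) :
    subwordProd b u ε 0 = 1 := by simp [subwordProd]

lemma subwordProd_cons_succ (i : b.support) (u : List b.support) (e : Fin 2)
    (ε : Fin u.length → Fin 2) (k : ℕ) :
    subwordProd b (i :: u) (Fin.cons e ε : Fin (u.length + 1) → Fin 2) (k + 1) =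
      simpleRefl b i ^ (e : ℕ) * subwordProd b u ε k := by
  rw [subwordProd, subwordProd]
  simp only [List.length_cons, List.ofFn_succ, List.take_succ_cons, List.prod_cons]
  rfl

variable [Finite ι] [P.IsReduced]

lemma exists_isPos_wordRoot_eq {u : List b.support} (hu : IsReducedWord b u) (j : Fin u.length) :
    ∃ k, b.IsPos k ∧ wordRoot b u j = P.root k := by
  have h : IsReducedWord b (u.take j ++ [u.get j]) := by
    have h1 : u.take j ++ [u.get j] = u.take (j + 1) := by simp
    rw [h1]
    exact IsReducedWord.of_append_left (v := u.drop (j + 1)) (by rwa [List.take_append_drop])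
  exact ⟨_, h.isPos_of_concat, P.weylGroup_apply_root _ _⟩

/-- A later root equal to the first would come from a positive root sent by $s_i$ to $\alpha_i$,
that is from $-\alpha_i$. Injectivity turns the product over the set $R(w)$ into one over positions.
-/
lemma wordRoot_injective {u : List b.support} (hu : IsReducedWord b u) :
    Function.Injective (wordRoot b u) := by
  induction u with
  | nil => exact fun j => j.elim0
  | cons i u ih =>
    have hu' : IsReducedWord b u := IsReducedWord.of_append_right (u := [i]) hu
    have hne (j : Fin u.length) : simpleRefl b i • wordRoot b u j ≠ P.root i := by
      intro h
      obtain ⟨k, hk, hk'⟩ := exists_isPos_wordRoot_eq b hu' j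
      rw [hk', P.weylGroup_apply_root] at h
      have hki : P.reflectionPerm i k = i := P.root.injective h
      have hk2 : k = P.reflectionPerm i i := by
        simpa using congr_arg (P.reflectionPerm i) hki
      have := isPos_perm_ofIdx_self_iff b (1 : P.weylGroup) i
      rw [one_mul, map_one, Equiv.Perm.one_apply, ofIdx_perm_ofIdx, ← hk2] at this
      exact this.1 hk (isPos_simple b i)
    intro j j' h
    induction j using Fin.cases with
    | zero =>
      induction j' using Fin.cases with
      | zero => rfl
      | succ j' =>
        exact absurd ((wordRoot_cons_succ b i u j').symm.trans
          (h.symm.trans (wordRoot_cons_zero b i u))) (hne j')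
    | succ j =>
      induction j' using Fin.cases with
      | zero =>
        exact absurd ((wordRoot_cons_succ b i u j).symm.trans
          (h.trans (wordRoot_cons_zero b i u))) (hne j)
      | succ j' =>
        have := (wordRoot_cons_succ b i u j).symm.trans (h.trans (wordRoot_cons_succ b i u j'))
        rw [ih hu' (smul_left_cancel _ this)]

variable [Module.Free ℤ Λ]

lemma bigA_eq_prod (w : P.weylGroup) :
    bigA b w = ∏ j, coeffA (wordRoot b (reducedWord b w) j) := by
  classical
  rw [bigA, inversionRoots]
  convert! Finset.prod_image ((wordRoot_injective b (isReducedWord_reducedWord b w)).injOn)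

lemma bigA_ne_zero (w : P.weylGroup) : bigA b w ≠ 0 := by
  rw [bigA_eq_prod]
  exact Finset.prod_ne_zero_iff.2 fun j _ => coeffA_ne_zero (smul_root_ne_zero _ _)

lemma heckeQHom_add_algebraMap (i : b.support) (c : CoeffRing Λ) :
    heckeQHom b (gen b i + algebraMap (CoeffRing Λ) (HeckeQ b) c) = dlElt b i + c • 1 := by
  rw [map_add, heckeQHom_gen, AlgHom.commutes, Algebra.algebraMap_eq_smul_one]

/-- Translates of Yang–Baxter elements act diagonally, up to a translation. -/
lemma heckeQHom_ybWord_single (u : List b.support) (w : P.weylGroup) (c : CoeffRing Λ) :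
    (heckeQHom b (List.ofFn fun j : Fin u.length => gen b (u.get j) +
      algebraMap (CoeffRing Λ) (HeckeQ b) (ybCoeff (w • wordRoot b u j))).prod).unop
        (Finsupp.single w c) =
      Finsupp.single (w * wordProd b u) (c * ∏ j, coeffA (w • wordRoot b u j)) := by
  induction u generalizing w c with
  | nil => simp
  | cons i u ih =>
    have h0 := List.ofFn_succ (n := u.length) (f := fun j : Fin (i :: u).length =>
      gen b ((i :: u).get j) +
        algebraMap (CoeffRing Λ) (HeckeQ b) (ybCoeff (w • wordRoot b (i :: u) j)))
    -- The first letter moves $w$ to $ws_i$, which is why the induction runs over all translates.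
    have h1 := ih (w * simpleRefl b i) (c * coeffA (w • P.root i))
    simp only [mul_smul, ← wordRoot_cons_succ] at h1
    have h2 : w • wordRoot b (i :: u) (0 : Fin (u.length + 1)) = w • P.root i :=
      congr_arg _ (wordRoot_cons_zero b i u)
    have h3 := Fin.prod_univ_succ (n := u.length) (fun j : Fin (i :: u).length =>
      coeffA (w • wordRoot b (i :: u) j))
    refine (congr_arg (fun z => (heckeQHom b z.prod).unop (Finsupp.single w c)) h0).trans ?_
    refine Eq.trans ?_ (congr_arg (fun z => Finsupp.single _ (c * z)) h3.symm)
    rw [h2, List.prod_cons, map_mul, heckeQHom_add_algebraMap, ← mul_assoc c, wordProd_cons,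
      ← mul_assoc w]
    exact (unop_dlElt_add_mul_single b i rfl _ _).trans h1

/-- The expansion of a product of Demazure–Lusztig elements over subwords. -/
lemma heckeQHom_prod_gen_single (u : List b.support) (w : P.weylGroup) (c : CoeffRing Λ) :
    (heckeQHom b (u.map (gen b)).prod).unop (Finsupp.single w c) =
      ∑ ε : Fin u.length → Fin 2, Finsupp.single (w * subwordProd b u ε u.length)
        (c * ∏ j, if ε j = 1 then coeffA ((w * subwordProd b u ε j) • P.root (u.get j))
          else coeffB ((w * subwordProd b u ε j) • P.root (u.get j))) := by
  induction u generalizing w c with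
  | nil => simp [subwordProd]
  | cons i u ih =>
    rw [List.map_cons, List.prod_cons, map_mul, heckeQHom_gen, MulOpposite.unop_mul,
      Module.End.mul_apply]
    change (heckeQHom b (u.map (gen b)).prod).unop (dlOp b i (Finsupp.single w c)) = _
    rw [dlOp_single, map_add, ih, ih]
    have h1 := Fintype.sum_equiv (Fin.consEquiv fun _ : Fin (u.length + 1) => Fin 2)
      (fun x => Finsupp.single (w * subwordProd b (i :: u) (Fin.cons x.1 x.2) (u.length + 1))
        (c * ∏ j : Fin (u.length + 1),
          if (Fin.cons x.1 x.2 : Fin (u.length + 1) → Fin 2) j = 1 then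
            coeffA ((w * subwordProd b (i :: u) (Fin.cons x.1 x.2) j) • P.root ((i :: u).get j))
          else
            coeffB ((w * subwordProd b (i :: u) (Fin.cons x.1 x.2) j) • P.root ((i :: u).get j))))
      (fun ε => Finsupp.single (w * subwordProd b (i :: u) ε (u.length + 1))
        (c * ∏ j : Fin (u.length + 1),
          if ε j = 1 then coeffA ((w * subwordProd b (i :: u) ε j) • P.root ((i :: u).get j))
          else coeffB ((w * subwordProd b (i :: u) ε j) • P.root ((i :: u).get j))))
      fun x => rfl
    refine Eq.trans ?_ h1
    rw [Fintype.sum_prod_type, Fin.sum_univ_two, add_comm]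
    have h2 (e : Fin 2) (ε : Fin u.length → Fin 2) :
        subwordProd b (i :: u) (Fin.cons e ε : Fin (u.length + 1) → Fin 2) 0 = 1 :=
      subwordProd_zero b _ _
    simp [Fin.prod_univ_succ, h2, subwordProd_cons_succ, mul_assoc]

end Expansion

/-! ### Unitriangularity, existence and comparison of coefficients. -/

section Triangularity

variable {ι Λ Λ' : Type*} [AddCommGroup Λ] [AddCommGroup Λ'] {P : RootDatum ι Λ Λ'} (b : P.Base)

open CoxeterSystem (alternatingWord)

lemma hgen_braid {i j : b.support} (hij : i ≠ j) :
    ((alternatingWord i j (orderOf (simpleRefl b i * simpleRefl b j))).map (hgen b)).prod =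
      ((alternatingWord j i (orderOf (simpleRefl b i * simpleRefl b j))).map (hgen b)).prod := by
  have h := RingQuot.mkAlgHom_rel ParamRing (HeckeRel.braid i j hij)
  rw [map_list_prod, map_list_prod, List.map_map, List.map_map] at h
  exact h

lemma hgen_mul_self (i : b.support) :
    (hgen b i - algebraMap ParamRing _ (MvPolynomial.X 0)) *
      (hgen b i - algebraMap ParamRing _ (MvPolynomial.X 1)) = 0 := by
  have h := RingQuot.mkAlgHom_rel ParamRing (HeckeRel.quadratic i)
  rw [map_mul, map_sub, map_sub, AlgHom.commutes, AlgHom.commutes, map_zero] at h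
  exact h

variable [Module.Free ℤ Λ]

lemma gen_eq_includeRight (i : b.support) :
    gen b i = (Algebra.TensorProduct.includeRight : Hecke b →ₐ[ParamRing] HeckeQ b) (hgen b i) :=
  rfl

lemma gen_braid {i j : b.support} (hij : i ≠ j) :
    ((alternatingWord i j (orderOf (simpleRefl b i * simpleRefl b j))).map (gen b)).prod =
      ((alternatingWord j i (orderOf (simpleRefl b i * simpleRefl b j))).map (gen b)).prod := by
  have h := congr_arg (Algebra.TensorProduct.includeRight : Hecke b →ₐ[ParamRing] HeckeQ b)
    (hgen_braid b hij)
  rw [map_list_prod, map_list_prod, List.map_map, List.map_map] at h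
  exact h

lemma gen_mul_self (i : b.support) :
    gen b i * gen b i = (t₁ Λ + t₂ Λ) • gen b i - (t₁ Λ * t₂ Λ) • 1 := by
  have h := congr_arg (Algebra.TensorProduct.includeRight : Hecke b →ₐ[ParamRing] HeckeQ b)
    (hgen_mul_self b i)
  rw [map_mul, map_sub, map_sub, AlgHom.commutes, AlgHom.commutes, map_zero,
    IsScalarTower.algebraMap_apply ParamRing (CoeffRing Λ) (HeckeQ b),
    IsScalarTower.algebraMap_apply ParamRing (CoeffRing Λ) (HeckeQ b),
    ← gen_eq_includeRight] at h
  change (gen b i - algebraMap _ (HeckeQ b) (t₁ Λ)) *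
    (gen b i - algebraMap _ (HeckeQ b) (t₂ Λ)) = 0 at h
  simp only [Algebra.algebraMap_eq_smul_one, sub_mul, mul_sub, smul_mul_assoc,
    mul_smul_comm, one_mul, mul_one] at h
  rw [← sub_eq_zero, ← h]
  module

variable [Finite ι] [P.IsReduced]

lemma prod_gen_eq_heckeBasis {u : List b.support} (hu : IsReducedWord b u) :
    (u.map (gen b)).prod = heckeBasis b (wordProd b u) :=
  prod_map_eq_of_isReducedWord (gen b) (fun _ _ hij => gen_braid b hij)
    (orderOf_simpleRefl_mul_pos b) hu (isReducedWord_reducedWord b _)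
    (wordProd_reducedWord b _).symm

lemma gen_mul_heckeBasis_of_lt {i : b.support} {w : P.weylGroup}
    (h : length b w < length b (simpleRefl b i * w)) :
    gen b i * heckeBasis b w = heckeBasis b (simpleRefl b i * w) := by
  have hred : IsReducedWord b (i :: reducedWord b w) :=
    (isReducedWord_cons_iff (isReducedWord_reducedWord b w)).2 (by rwa [wordProd_reducedWord])
  have := prod_gen_eq_heckeBasis b hred
  rwa [List.map_cons, List.prod_cons, wordProd_cons, wordProd_reducedWord] at this

lemma gen_mul_heckeBasis_of_gt {i : b.support} {w : P.weylGroup}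
    (h : length b (simpleRefl b i * w) < length b w) :
    gen b i * heckeBasis b w =
      (t₁ Λ + t₂ Λ) • heckeBasis b w - (t₁ Λ * t₂ Λ) • heckeBasis b (simpleRefl b i * w) := by
  have h1 := gen_mul_heckeBasis_of_lt b (i := i) (w := simpleRefl b i * w)
    (by rwa [simpleRefl_mul_cancel])
  rw [simpleRefl_mul_cancel] at h1
  rw [← h1, ← mul_assoc, gen_mul_self, sub_mul, smul_mul_assoc, smul_mul_assoc, one_mul]

/-- The span of the `h_x` with `x < w`. -/
def strictSpan (w : P.weylGroup) : Submodule (CoeffRing Λ) (HeckeQ b) :=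
  Submodule.span _ (heckeBasis b '' {x | BruhatLE b x w ∧ x ≠ w})

variable {b}

lemma heckeBasis_mem_strictSpan {x w : P.weylGroup} (h : BruhatLE b x w) (hne : x ≠ w) :
    heckeBasis b x ∈ strictSpan b w := Submodule.subset_span ⟨x, ⟨h, hne⟩, rfl⟩

/-- The product $h_i h_x$ involves only $h_x$ and $h_{s_ix}$. The lifting property puts $s_ix$ below
$s_iw$, and cancellation makes this strict. -/
lemma mem_strictSpan_simpleRefl_mul {i : b.support} {w : P.weylGroup}
    (h : length b w < length b (simpleRefl b i * w)) {r : HeckeQ b} (hr : r ∈ strictSpan b w) :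
    r ∈ strictSpan b (simpleRefl b i * w) ∧ gen b i * r ∈ strictSpan b (simpleRefl b i * w) := by
  have hw := bruhatLE_simpleRefl_mul h
  induction hr using Submodule.span_induction with
  | mem r hr =>
    obtain ⟨x, ⟨hx, hne⟩, rfl⟩ := hr
    have h1 : heckeBasis b x ∈ strictSpan b (simpleRefl b i * w) := by
      refine heckeBasis_mem_strictSpan (hx.trans hw) ?_
      rintro rfl
      exact hne (hx.antisymm hw)
    have h2 : heckeBasis b (simpleRefl b i * x) ∈ strictSpan b (simpleRefl b i * w) :=
      heckeBasis_mem_strictSpan ((hx.simpleRefl_mul i).elim (fun h => h.trans hw) id)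
        fun h => hne (mul_left_cancel h)
    refine ⟨h1, ?_⟩
    rcases lt_or_gt_of_ne (length_simpleRefl_mul_ne b i x) with h3 | h3
    · rw [gen_mul_heckeBasis_of_gt b h3]
      exact sub_mem (Submodule.smul_mem _ _ h1) (Submodule.smul_mem _ _ h2)
    · rwa [gen_mul_heckeBasis_of_lt b h3]
  | zero => simp
  | add x y _ _ hx hy =>
    rw [mul_add]
    exact ⟨add_mem hx.1 hy.1, add_mem hx.2 hy.2⟩
  | smul c x _ hx =>
    rw [mul_smul_comm]
    exact ⟨Submodule.smul_mem _ _ hx.1, Submodule.smul_mem _ _ hx.2⟩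

/-- A product of factors `h_i + c` along a reduced word of `w` is `h_w` up to lower terms. -/
lemma prod_gen_add_sub_mem_strictSpan {u : List b.support} (hu : IsReducedWord b u)
    (c : Fin u.length → CoeffRing Λ) :
    (List.ofFn fun j => gen b (u.get j) + algebraMap (CoeffRing Λ) (HeckeQ b) (c j)).prod -
      heckeBasis b (wordProd b u) ∈ strictSpan b (wordProd b u) := by
  induction u with
  | nil =>
    have := prod_gen_eq_heckeBasis b hu
    simp only [List.map_nil, List.prod_nil, wordProd_nil] at this
    simp [← this]
  | cons i u ih =>
    have hu' : IsReducedWord b u := IsReducedWord.of_append_right (u := [i]) hu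
    have hlt := (isReducedWord_cons_iff hu').1 hu
    obtain ⟨r, hr, hX⟩ : ∃ r ∈ strictSpan b (wordProd b u), (List.ofFn fun j : Fin u.length =>
        gen b (u.get j) + algebraMap (CoeffRing Λ) (HeckeQ b) (c j.succ)).prod =
          heckeBasis b (wordProd b u) + r :=
      ⟨_, ih hu' fun j => c j.succ, (add_sub_cancel _ _).symm⟩
    have h0 := List.ofFn_succ (n := u.length) (f := fun j : Fin (i :: u).length =>
      gen b ((i :: u).get j) + algebraMap (CoeffRing Λ) (HeckeQ b) (c j))
    refine (congr_arg (fun z => z.prod - heckeBasis b (wordProd b (i :: u)) ∈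
      strictSpan b (wordProd b (i :: u))) h0).mpr ?_
    have h1 := congr_arg (fun z => (gen b i +
      algebraMap (CoeffRing Λ) (HeckeQ b) (c (0 : Fin (u.length + 1)))) * z) hX
    rw [List.prod_cons]
    refine (congr_arg (fun z => z - heckeBasis b (wordProd b (i :: u)) ∈
      strictSpan b (wordProd b (i :: u))) h1).mpr ?_
    simp only [wordProd_cons]
    rw [Algebra.algebraMap_eq_smul_one, add_mul, mul_add, gen_mul_heckeBasis_of_lt b hlt,
      smul_mul_assoc, one_mul, add_assoc, add_sub_cancel_left]
    obtain ⟨h2, h3⟩ := mem_strictSpan_simpleRefl_mul hlt hr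
    refine add_mem h3 (Submodule.smul_mem _ _ (add_mem ?_ h2))
    refine heckeBasis_mem_strictSpan (bruhatLE_simpleRefl_mul hlt) fun h => ?_
    rw [← h] at hlt
    exact lt_irrefl _ hlt

lemma ybBasis_sub_heckeBasis_mem (w : P.weylGroup) :
    ybBasis b w - heckeBasis b w ∈ strictSpan b w := by
  have := prod_gen_add_sub_mem_strictSpan (isReducedWord_reducedWord b w)
    fun j => ybCoeff (wordRoot b _ j)
  rwa [wordProd_reducedWord] at this

/-- A unitriangular change of family is inverted by induction on length: $h_v = Y_v - (Y_v - h_v)$,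
with the bracket in the span of smaller $h_x$. -/
lemma heckeBasis_mem_span_ybBasis (v : P.weylGroup) :
    heckeBasis b v ∈ Submodule.span (CoeffRing Λ) (ybBasis b '' {x | BruhatLE b x v}) := by
  induction hn : length b v using Nat.strong_induction_on generalizing v with
  | _ n ih =>
    rw [← sub_sub_cancel (ybBasis b v) (heckeBasis b v)]
    refine sub_mem (Submodule.subset_span ⟨v, BruhatLE.refl b v, rfl⟩) ?_
    refine Submodule.span_le.2 ?_ (ybBasis_sub_heckeBasis_mem v)
    rintro _ ⟨x, ⟨hx, hne⟩, rfl⟩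
    have hlt := hx.eq_or_length_lt.resolve_left hne
    refine Submodule.span_mono (Set.image_mono fun y hy => ?_) (ih _ (hn ▸ hlt) x rfl)
    exact BruhatLE.trans hy hx

variable (b) in
lemma exists_isTransition : ∃ p : P.weylGroup → P.weylGroup →₀ CoeffRing Λ, IsTransition b p := by
  have h (v : P.weylGroup) := (Finsupp.mem_span_image_iff_linearCombination _).1
    (heckeBasis_mem_span_ybBasis (b := b) v)
  choose p hp hp' using h
  refine ⟨p, fun v w hne => hp v (Finsupp.mem_support_iff.2 hne), fun v => (hp' v).symm⟩

/-! ### Coefficients -/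

lemma heckeQHom_ybBasis_single (w : P.weylGroup) :
    (heckeQHom b (ybBasis b w)).unop (Finsupp.single 1 1) = Finsupp.single w (bigA b w) := by
  have h := heckeQHom_ybWord_single b (reducedWord b w) 1 1
  simp only [one_smul, one_mul, wordProd_reducedWord] at h
  rw [bigA_eq_prod, ← h]
  rfl

/-- Applied to the basis vector $1$, each $Y_x$ gives a multiple of $x$ alone, so the coordinate at
$w$ isolates one coefficient. -/
lemma IsTransition.mul_bigA {p : P.weylGroup → P.weylGroup →₀ CoeffRing Λ}
    (hp : IsTransition b p) (v w : P.weylGroup) :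
    p v w * bigA b w = (heckeQHom b (heckeBasis b v)).unop (Finsupp.single 1 1) w := by
  classical
  rw [hp.2 v, Finsupp.sum, map_sum, Finset.unop_sum, LinearMap.sum_apply, Finsupp.finsetSum_apply]
  simp only [map_smul, MulOpposite.unop_smul, LinearMap.smul_apply, heckeQHom_ybBasis_single,
    Finsupp.smul_apply, Finsupp.single_apply, smul_eq_mul]
  simp only [mul_ite, mul_zero, Finset.sum_ite_eq', Finsupp.mem_support_iff]
  split_ifs with h
  · rfl
  · rw [not_not.1 h, zero_mul]

lemma IsTransition.unique {p q : P.weylGroup → P.weylGroup →₀ CoeffRing Λ}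
    (hp : IsTransition b p) (hq : IsTransition b q) : p = q := by
  funext v
  ext w
  exact mul_right_cancel₀ (bigA_ne_zero b w) ((hp.mul_bigA v w).trans (hq.mul_bigA v w).symm)

/-- Matsumoto's theorem lets any reduced word compute $h_v$; the subword expansion at $1$ then
applies. -/
lemma heckeQHom_heckeBasis_single [DecidableEq P.weylGroup] {u : List b.support}
    (hu : IsReducedWord b u) (w : P.weylGroup) :
    (heckeQHom b (heckeBasis b (wordProd b u))).unop (Finsupp.single 1 1) w =
      ∑ ε : Fin u.length → Fin 2 with subwordProd b u ε u.length = w, ∏ j, coeffC b u ε j := by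
  rw [← prod_gen_eq_heckeBasis b hu, heckeQHom_prod_gen_single, Finsupp.finsetSum_apply,
    Finset.sum_filter]
  refine Finset.sum_congr rfl fun ε _ => ?_
  simp only [one_mul, Finsupp.single_apply, coeffC, apply_ite (coeffAct _), coeffAct_coeffA,
    coeffAct_coeffB]

end Triangularity

end

end YangBaxter

theorem corollary2 {ι Λ Λ' : Type*} [Finite ι]
    [AddCommGroup Λ] [Module.Free ℤ Λ] [Module.Finite ℤ Λ]
    [AddCommGroup Λ'] [Module.Free ℤ Λ'] [Module.Finite ℤ Λ']
    (P : RootDatum ι Λ Λ') [P.IsReduced] [DecidableEq P.weylGroup] (b : P.Base)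
    (hss : Module.finrank ℤ Λ = b.support.card) :
    (∃! p : P.weylGroup → P.weylGroup →₀ YangBaxter.CoeffRing Λ,
      YangBaxter.IsTransition b p) ∧
    (∀ w : P.weylGroup, YangBaxter.bigA b w ≠ 0) ∧
    ∀ p : P.weylGroup → P.weylGroup →₀ YangBaxter.CoeffRing Λ, YangBaxter.IsTransition b p →
      ∀ u : List b.support, YangBaxter.IsReducedWord b u → ∀ w : P.weylGroup,
        algebraMap (YangBaxter.CoeffRing Λ) (FractionRing (YangBaxter.CoeffRing Λ))
            (p (YangBaxter.wordProd b u) w) =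
          1 / algebraMap (YangBaxter.CoeffRing Λ) (FractionRing (YangBaxter.CoeffRing Λ))
              (YangBaxter.bigA b w) *
            algebraMap (YangBaxter.CoeffRing Λ) (FractionRing (YangBaxter.CoeffRing Λ))
              (∑ ε : Fin u.length → Fin 2 with YangBaxter.subwordProd b u ε u.length = w,
                ∏ j : Fin u.length, YangBaxter.coeffC b u ε j) := by
  obtain ⟨p, hp⟩ := YangBaxter.exists_isTransition b
  refine ⟨⟨p, hp, fun q hq => hq.unique hp⟩, YangBaxter.bigA_ne_zero b, fun q hq u hu w => ?_⟩
  have hA : algebraMap (YangBaxter.CoeffRing Λ) (FractionRing (YangBaxter.CoeffRing Λ))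
      (YangBaxter.bigA b w) ≠ 0 := by
    rw [Ne, map_eq_zero_iff _ (IsFractionRing.injective _ _)]
    exact YangBaxter.bigA_ne_zero b w
  rw [← YangBaxter.heckeQHom_heckeBasis_single hu, ← hq.mul_bigA, map_mul, one_div,
    mul_comm (algebraMap _ _ (q _ _)), inv_mul_cancel_left₀ hA]
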